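/- **Setting.** Let $\mathbb{R}^{4,1}$ be $\mathbb{R}^5$ with an inner product $(\cdot,\cdot)$ of signature $(4,1)$, $\mathcal{L}$ its light cone (non-zero null vectors), and $S^3\cong\mathbb{P}(\mathcal{L})$. For $w\in\mathbb{R}^{4,1}\setminus\{0\}$ let $E(w)=\{x\in\mathcal{L}:(x,w)=-1\}$, a $3$-dimensional space form of curvature $-(w,w)$. For $a,b\in\mathbb{R}^{4,1}$ let $a\wedge b$ be the skew endomorphism $(a\wedge b)x=(a,x)b-(b,x)a$. An *isothermic surface* $(\Lambda,\eta)$ in $S^3$ is an immersion of a surface into $\mathbb{P}(\mathcal{L})$, viewed as a null line subbundle $\Lambda$ of the trivial $\mathbb{R}^{4,1}$-bundle, with a non-zero closed $1$-form $\eta$ with values in $\Lambda\wedge\Lambda^{\perp}$. A *polynomial conserved quantity of degree $d$* is $p(t)=\sum_{k=0}^d p_kt^k$, with smooth sections $p_k$ of the trivial $\mathbb{R}^{4,1}$-bundle and $p_d\not\equiv0$, such that $(\mathrm{d}+t\eta)p(t)=0$ for all $t\in\mathbb{R}$. $(\Lambda,\eta)$ is *special isothermic of type $d$ in $E(w)$*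 if it has a polynomial conserved quantity of degree $d$ with $p_0\in\langle w\rangle$. **Theorem.** Let $(\Lambda,\eta)$ be an isothermic surface in $S^3$ defined on a (non-empty) connected open set $U$ of the $(u,v)$-plane, let $w\in\mathbb{R}^{4,1}\setminus\{0\}$, let $F:U\to E(w)$ be a smooth lift of $\Lambda$ and $N$ a smooth unit normal to $F$ in $E(w)$. Assume that $(u,v)$ are conformal curvature line coordinates of $F$, $$I=e^{2\theta}(\mathrm{d}u^2+\mathrm{d}v^2),\qquad I\!I=e^{2\theta}(k_1\,\mathrm{d}u^2+k_2\,\mathrm{d}v^2),$$ corresponding to $\eta$, that is, the quadratic differential $q$ defined by $\tfrac12q(X,Y)F=\eta_X\,\mathrm{d}F(Y)$ has $q^{2,0}=\mathrm{d}z^2$, $z=u+iv$. Put $H=\tfrac12(k_1+k_2)$, $L=e^{2\theta}(k_1-k_2)$, $M=-HL$. For real constants $A,B,C$ consider the system on $U$ $$\begin{cases} H_{uu}+\theta_uH_u-\theta_vH_v-\tfrac12Mk_1-Ak_1-Be^{-2\theta}+C-\tfrac12L(w,w)=0,\\ H_{vv}-\theta_uH_u+\theta_vH_v+\tfrac12Mk_2+Ak_2-Be^{-2\theta}-C+\tfrac12L(w,w)=0.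 \end{cases}\tag{1}$$ 1. $(\Lambda,\eta)$ is special isothermic of type $2$ in $E(w)$ if and only if there are real constants $A,B,C$ satisfying (1). 2. The polynomial conserved quantities $p$ of degree $2$ of $(\Lambda,\eta)$ with $p_0\in\langle w\rangle$ are exactly the $p(t)=c\,(p_0+p_1t+p_2t^2)$ where $c\neq0$ is a real constant and $$\begin{aligned}p_0&=Bw,\\ p_1&=\bigl(\tfrac12L(w,w)-C\bigr)F-e^{\theta}H_uW_1+e^{\theta}H_vW_2-\bigl(\tfrac12M+A\bigr)N+\tfrac12Lw,\\ p_2&=HF+N,\end{aligned}$$ with $W_1=e^{-\theta}F_u$, $W_2=e^{-\theta}F_v$, and $A,B,C$ real constants satisfying (1). 3. If $A,B,C$ satisfy (1), then there is a real constant $D$ such that the Darboux–Bianchi condition $$e^{2\theta}(H_u^2+H_v^2)+\tfrac14M^2+AM-2BH+CL+D+\tfrac14L^2K=0,\qquad K=-(w,w),\tag{2}$$ holds on $U$. If $H_uH_v$ vanishes nowhere on $U$, then conversely, for given $A,B,C$, the existence of a $D$ with (2) implies (1); so in that case $(\Lambda,\eta)$ is special isothermic of type $2$ in $E(w)$ if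 and only if (2) holds for some real constants $A,B,C,D$. -/

import Mathlib

open scoped ContDiff

namespace Isothermic

/-! ### The Lorentzian space `ℝ^{4,1}` -/

/-- The vector space underlying `ℝ^{4,1}`. -/
abbrev V : Type := Fin 5 → ℝ

/-- The Lorentzian inner product
`(x, y) = x₀y₀ + x₁y₁ + x₂y₂ + x₃y₃ - x₄y₄` of signature `(4,1)`. -/
noncomputable def lor : V →ₗ[ℝ] V →ₗ[ℝ] ℝ :=
  LinearMap.mk₂ ℝ
    (fun x y => x 0 * y 0 + x 1 * y 1 + x 2 * y 2 + x 3 * y 3 - x 4 * y 4)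
    (by intro a b c; simp only [Pi.add_apply]; ring)
    (by intro a b c; simp only [Pi.smul_apply, smul_eq_mul]; ring)
    (by intro a b c; simp only [Pi.add_apply]; ring)
    (by intro a b c; simp only [Pi.smul_apply, smul_eq_mul]; ring)

/-- The skew endomorphism `a ∧ b` of `ℝ^{4,1}`, `(a ∧ b) x = (a, x) b - (b, x) a`. -/
noncomputable def wedge (a b : V) : V →L[ℝ] V :=
  LinearMap.toContinuousLinearMap ((lor a).smulRight b - (lor b).smulRight a)

/-- The light cone: the non-zero null vectors of `ℝ^{4,1}`.
The conformal 3-sphere is its projectivisation. -/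
def lightCone : Set V := {x | x ≠ 0 ∧ lor x x = 0}

/-- The conic section `E(w) = {x ∈ 𝓛 : (x, w) = -1}`; for `w ≠ 0`
it is a space form of sectional curvature `-(w, w)`. -/
def spaceForm (w : V) : Set V := {x | x ∈ lightCone ∧ lor x w = -1}

/-- For a subspace `S` of `ℝ^{4,1}`, the space `S ∧ S^⊥` of skew endomorphisms
spanned by all `a ∧ b` with `a ∈ S` and `b` orthogonal to `S`. -/
noncomputable def wedgePerp (S : Submodule ℝ V) : Submodule ℝ (V →L[ℝ] V) :=
  Submodule.span ℝ {T | ∃ a ∈ S, ∃ b : V, (∀ s ∈ S, lor s b = 0) ∧ T = wedge a b}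

/-! ### Surfaces in the conformal 3-sphere, over a plane domain with coordinates `(u, v)` -/

/-- Partial derivative with respect to the first coordinate `u`. -/
noncomputable def du {E : Type*} [NormedAddCommGroup E] [NormedSpace ℝ E]
    (f : ℝ × ℝ → E) (x : ℝ × ℝ) : E := fderiv ℝ f x (1, 0)

/-- Partial derivative with respect to the second coordinate `v`. -/
noncomputable def dv {E : Type*} [NormedAddCommGroup E] [NormedSpace ℝ E]
    (f : ℝ × ℝ → E) (x : ℝ × ℝ) : E := fderiv ℝ f x (0, 1)

/-- `F` is a lift (a smooth, nowhere zero section) over `U` of the line bundle `Λ`,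
and `Λ` is null over `U`. -/
structure IsLift (U : Set (ℝ × ℝ)) (Λ : ℝ × ℝ → Submodule ℝ V) (F : ℝ × ℝ → V) : Prop where
  smooth : ContDiffOn ℝ ∞ F U
  mem_lightCone : ∀ x ∈ U, F x ∈ lightCone
  span_eq : ∀ x ∈ U, Λ x = Submodule.span ℝ {F x}

/-- `Λ` is a smooth null line subbundle of the trivial bundle `U × ℝ^{4,1}`, that is, a smooth
map from `U` to the conformal 3-sphere, and this map is an immersion:
`F, F_u, F_v` are linearly independent for each local lift `F`. -/
structure IsImmersedSurface (U : Set (ℝ × ℝ)) (Λ : ℝ × ℝ → Submodule ℝ V) : Prop where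
  exists_lift : ∀ x ∈ U, ∃ W ⊆ U, IsOpen W ∧ x ∈ W ∧ ∃ F, IsLift W Λ F
  immersion : ∀ W ⊆ U, IsOpen W → ∀ F, IsLift W Λ F →
    ∀ x ∈ W, LinearIndependent ℝ ![F x, du F x, dv F x]

/-- `(Λ, η)` is an isothermic surface over `U`: `Λ` is an immersed surface in the conformal
3-sphere and `η` is a non-zero closed 1-form with values in `Λ ∧ Λ^⊥`. -/
structure IsIsothermic (U : Set (ℝ × ℝ)) (Λ : ℝ × ℝ → Submodule ℝ V)
    (η : ℝ × ℝ → (ℝ × ℝ →L[ℝ] V →L[ℝ] V)) : Prop where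
  surface : IsImmersedSurface U Λ
  smooth : ContDiffOn ℝ ∞ η U
  mem_wedgePerp : ∀ x ∈ U, ∀ X, η x X ∈ wedgePerp (Λ x)
  closed : ∀ x ∈ U, ∀ X Y, fderiv ℝ η x X Y = fderiv ℝ η x Y X
  ne_zero : ∃ x ∈ U, η x ≠ 0

/-! ### Polynomial conserved quantities -/

/-- The value at `t` of the polynomial `∑ₖ pₖ tᵏ` whose coefficients are sections. -/
noncomputable def polyEval {d : ℕ} (p : Fin (d + 1) → ℝ × ℝ → V) (t : ℝ) (x : ℝ × ℝ) : V :=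
  ∑ k : Fin (d + 1), t ^ (k : ℕ) • p k x

/-- `p(t) = ∑ₖ pₖ tᵏ` is a polynomial conserved quantity of degree `d`: the coefficients are
smooth sections of the trivial bundle over `U`, the top one is not identically zero, and
`(d + t η) p(t) = 0` for all real `t`. -/
structure IsConservedQuantity (U : Set (ℝ × ℝ)) (η : ℝ × ℝ → (ℝ × ℝ →L[ℝ] V →L[ℝ] V))
    (d : ℕ) (p : Fin (d + 1) → ℝ × ℝ → V) : Prop where
  smooth : ∀ k, ContDiffOn ℝ ∞ (p k) U
  top_ne_zero : ∃ x ∈ U, p (Fin.last d) x ≠ 0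
  parallel : ∀ t : ℝ, ∀ x ∈ U, ∀ X : ℝ × ℝ,
    fderiv ℝ (polyEval p t) x X + t • η x X (polyEval p t x) = 0

/-- `(Λ, η)` is special isothermic of type `d` in the space form `E(w)`: it is isothermic and
has a polynomial conserved quantity of degree `d` with constant term in `⟨w⟩`. -/
def IsSpecialIsothermic (U : Set (ℝ × ℝ)) (Λ : ℝ × ℝ → Submodule ℝ V)
    (η : ℝ × ℝ → (ℝ × ℝ →L[ℝ] V →L[ℝ] V)) (d : ℕ) (w : V) : Prop :=
  IsIsothermic U Λ η ∧ ∃ p : Fin (d + 1) → ℝ × ℝ → V, IsConservedQuantity U η d p ∧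
    ∀ x ∈ U, p 0 x ∈ Submodule.span ℝ {w}

/-! ### Geometry of a lift into a space form -/

/-- `N` is a smooth unit normal field over `U` to the map `F` into `E(w)`; the tangent space of
`E(w)` at `F x` is the orthogonal complement of `F x` and `w`. -/
structure IsUnitNormal (U : Set (ℝ × ℝ)) (w : V) (F N : ℝ × ℝ → V) : Prop where
  smooth : ContDiffOn ℝ ∞ N U
  unit : ∀ x ∈ U, lor (N x) (N x) = 1
  tangent : ∀ x ∈ U, lor (N x) (F x) = 0 ∧ lor (N x) w = 0
  normal : ∀ x ∈ U, ∀ X, lor (N x) (fderiv ℝ F x X) = 0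

/-- The first fundamental form `I(X, Y) = (dF(X), dF(Y))`. -/
noncomputable def firstForm (F : ℝ × ℝ → V) (x X Y : ℝ × ℝ) : ℝ :=
  lor (fderiv ℝ F x X) (fderiv ℝ F x Y)

/-- The second fundamental form with respect to the unit normal `N`:
`II(X, Y) = (D_X D_Y F, N)` for constant vector fields `X, Y`. -/
noncomputable def secondForm (F N : ℝ × ℝ → V) (x X Y : ℝ × ℝ) : ℝ :=
  lor (fderiv ℝ (fun y => fderiv ℝ F y Y) x X) (N x)

/-- The coordinates `(u, v)` on `U` are conformal curvature line coordinates for `F` with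
conformal factor `e^{2θ}` and principal curvatures `k₁, k₂`:
`I = e^{2θ}(du² + dv²)` and `II = e^{2θ}(k₁ du² + k₂ dv²)`. -/
def IsConformalCurvatureLine (U : Set (ℝ × ℝ)) (F N : ℝ × ℝ → V) (θ k₁ k₂ : ℝ × ℝ → ℝ) : Prop :=
  ∀ x ∈ U, ∀ X Y : ℝ × ℝ,
    firstForm F x X Y = Real.exp (2 * θ x) * (X.1 * Y.1 + X.2 * Y.2) ∧
    secondForm F N x X Y = Real.exp (2 * θ x) * (k₁ x * (X.1 * Y.1) + k₂ x * (X.2 * Y.2))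

/-- The coordinates `z = u + iv` correspond to `η`: the quadratic differential `q` given by
`½ q(X, Y) F = η_X dF(Y)` has `q^{2,0} = dz²`, that is, `q = 2 Re(dz²) = 2 (du² - dv²)`. -/
def CoordsCorrespond (U : Set (ℝ × ℝ)) (η : ℝ × ℝ → (ℝ × ℝ →L[ℝ] V →L[ℝ] V))
    (F : ℝ × ℝ → V) : Prop :=
  ∀ x ∈ U, ∀ X Y : ℝ × ℝ,
    η x X (fderiv ℝ F x Y) = ((1 / 2 : ℝ) * (2 * (X.1 * Y.1 - X.2 * Y.2))) • F x

/-- The mean curvature `H = (k₁ + k₂)/2`. -/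
noncomputable def meanCurv (k₁ k₂ : ℝ × ℝ → ℝ) (x : ℝ × ℝ) : ℝ := (k₁ x + k₂ x) / 2

/-- `L = e^{2θ}(k₁ - k₂)`. -/
noncomputable def fnL (θ k₁ k₂ : ℝ × ℝ → ℝ) (x : ℝ × ℝ) : ℝ :=
  Real.exp (2 * θ x) * (k₁ x - k₂ x)

/-- `M = -HL`. -/
noncomputable def fnM (θ k₁ k₂ : ℝ × ℝ → ℝ) (x : ℝ × ℝ) : ℝ :=
  -(meanCurv k₁ k₂ x * fnL θ k₁ k₂ x)

/-- The pair of second order equations for `H` on `U`, with constants `A, B, C`;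
`s` stands for the number `(w, w)`. -/
def BianchiSystem (U : Set (ℝ × ℝ)) (θ k₁ k₂ : ℝ × ℝ → ℝ) (s A B C : ℝ) : Prop :=
  let H := meanCurv k₁ k₂
  let L := fnL θ k₁ k₂
  let M := fnM θ k₁ k₂
  ∀ x ∈ U,
    du (du H) x + du θ x * du H x - dv θ x * dv H x - 1 / 2 * M x * k₁ x - A * k₁ x
        - B * Real.exp (-2 * θ x) + C - 1 / 2 * L x * s = 0 ∧
    dv (dv H) x - du θ x * du H x + dv θ x * dv H x + 1 / 2 * M x * k₂ x + A * k₂ x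
        - B * Real.exp (-2 * θ x) - C + 1 / 2 * L x * s = 0

/-- The classical Darboux–Bianchi condition of class `(A, B, C, D)` on `U`, for a surface in a
space form of curvature `K`. -/
def DarbouxBianchi (U : Set (ℝ × ℝ)) (θ k₁ k₂ : ℝ × ℝ → ℝ) (K A B C D : ℝ) : Prop :=
  let H := meanCurv k₁ k₂
  let L := fnL θ k₁ k₂
  let M := fnM θ k₁ k₂
  ∀ x ∈ U,
    Real.exp (2 * θ x) * (du H x ^ 2 + dv H x ^ 2) + 1 / 4 * M x ^ 2 + A * M x - 2 * B * H x
      + C * L x + D + 1 / 4 * L x ^ 2 * K = 0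

/-- The coefficients `p₀, p₁, p₂` of the explicit quadratic polynomial
`p₀ = B w`,
`p₁ = (½ L (w, w) - C) F - e^θ H_u W₁ + e^θ H_v W₂ - (½ M + A) N + ½ L w`,
`p₂ = H F + N`, where `W₁ = e^{-θ} F_u` and `W₂ = e^{-θ} F_v`. -/
noncomputable def explicitQuantity (w : V) (F N : ℝ × ℝ → V) (θ k₁ k₂ : ℝ × ℝ → ℝ)
    (A B C : ℝ) : Fin 3 → ℝ × ℝ → V :=
  let H := meanCurv k₁ k₂
  let L := fnL θ k₁ k₂
  let M := fnM θ k₁ k₂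
  let W₁ : ℝ × ℝ → V := fun x => Real.exp (-θ x) • du F x
  let W₂ : ℝ × ℝ → V := fun x => Real.exp (-θ x) • dv F x
  ![fun _ => B • w,
    fun x => (1 / 2 * L x * lor w w - C) • F x - (Real.exp (θ x) * du H x) • W₁ x
      + (Real.exp (θ x) * dv H x) • W₂ x - (1 / 2 * M x + A) • N x + (1 / 2 * L x) • w,
    fun x => H x • F x + N x]

end Isothermic

/-!
The frame `F, F_u, F_v, N, w` is a basis of `ℝ^{4,1}` at each point: its Gram matrix is that of
`IsAdaptedFrame`. In curvature line coordinates the derivatives of the frame are given by the Gauss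
and Weingarten equations collected in `IsCurvatureLineFrame`, and `N_uv = N_vu` yields the Codazzi
equations. In terms of `H`, `L`, `M` these say
`L_u = 2e^{2θ}H_u`, `L_v = -2e^{2θ}H_v`, `M_u = -2e^{2θ}k₁H_u`, `M_v = 2e^{2θ}k₂H_v` and
`H_uv = -θ_v H_u - θ_u H_v`. The Gauss equation for the intrinsic curvature is never needed.

Since `η` takes values in `Λ ∧ Λ^⊥`, it is skew and kills `F`; the correspondence with `du² - dv²`
gives its values on `dF`, and closedness removes the one remaining component, so that
`η = e^{-2θ} F ∧ (-F_u du + F_v dv)` (`IsCurvatureLineFrame.isFrameForm`).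

For `p = p₀ + p₁ t + p₂ t²` the equation `(d + tη) p = 0` means `dp₀ = 0`, `dp₁ + ηp₀ = 0`,
`dp₂ + ηp₁ = 0` and `ηp₂ = 0` (`parallel_two_iff`). Thus `p₀` is a constant multiple of `w`, the
last equation puts `p₂` in the span of `F` and `N`, and the third makes the `N`-component a
constant `c`, forces `p₂ = c (HF + N)` and determines all components of `p₁` except those along `F`
and `N`. The second equation gives these two, up to constants `C` and `A`, because the derivatives
they must have are those of `½ L (w, w)` and `-½ M`; its `F_u`- and `F_v`-components are then
exactly the two equations of the Bianchi system
(`IsCurvatureLineFrame.dirDeriv_explicitQuantity_one`,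
`IsCurvatureLineFrame.exists_explicit_of_isConservedQuantity`).

Finally, let `G` be the left-hand side of the Darboux–Bianchi condition without `D`, and let `S₁`,
`S₂` be the left-hand sides of the Bianchi system. Then `G_u = 2e^{2θ}H_u S₁` and
`G_v = 2e^{2θ}H_v S₂` (`IsCurvatureLineFrame.du_darbouxFn`, `IsCurvatureLineFrame.dv_darbouxFn`), so
the system makes `G` constant, and the converse holds where `H_u H_v` does not vanish.
-/

namespace Isothermic

/-! ### Directional derivatives on an open set -/

section Calculus

variable {E : Type*} [NormedAddCommGroup E] [NormedSpace ℝ E]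

/-- The derivative of `f` along the constant vector field `X`; `du` and `dv` are the cases
`X = (1, 0)` and `X = (0, 1)`. -/
noncomputable def dirDeriv (X : ℝ × ℝ) (f : ℝ × ℝ → E) (x : ℝ × ℝ) : E := fderiv ℝ f x X

theorem du_eq_dirDeriv (f : ℝ × ℝ → E) : du f = dirDeriv (1, 0) f := rfl

theorem dv_eq_dirDeriv (f : ℝ × ℝ → E) : dv f = dirDeriv (0, 1) f := rfl

theorem fderiv_apply_eq_du_dv (f : ℝ × ℝ → E) (x X : ℝ × ℝ) :
    fderiv ℝ f x X = X.1 • du f x + X.2 • dv f x := by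
  have h : X = X.1 • ((1 : ℝ), (0 : ℝ)) + X.2 • ((0 : ℝ), (1 : ℝ)) := by
    ext <;> simp
  conv_lhs => rw [h]
  rw [map_add, map_smul, map_smul]
  rfl

variable {U : Set (ℝ × ℝ)} {x : ℝ × ℝ} (X Y : ℝ × ℝ)

theorem contDiffOn_dirDeriv (hU : IsOpen U) {f : ℝ × ℝ → E} (hf : ContDiffOn ℝ ∞ f U) :
    ContDiffOn ℝ ∞ (dirDeriv X f) U :=
  (hf.fderiv_of_isOpen hU (m := ∞) (by simp)).clm_apply contDiffOn_const

theorem contDiffOn_du (hU : IsOpen U) {f : ℝ × ℝ → E} (hf : ContDiffOn ℝ ∞ f U) :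
    ContDiffOn ℝ ∞ (du f) U := contDiffOn_dirDeriv _ hU hf

theorem contDiffOn_dv (hU : IsOpen U) {f : ℝ × ℝ → E} (hf : ContDiffOn ℝ ∞ f U) :
    ContDiffOn ℝ ∞ (dv f) U := contDiffOn_dirDeriv _ hU hf

theorem differentiableAt_of_contDiffOn (hU : IsOpen U) (hx : x ∈ U) {f : ℝ × ℝ → E}
    (hf : ContDiffOn ℝ ∞ f U) : DifferentiableAt ℝ f x :=
  (hf.contDiffAt (hU.mem_nhds hx)).differentiableAt (by simp)

theorem dirDeriv_congr (hU : IsOpen U) (hx : x ∈ U) {f g : ℝ × ℝ → E}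
    (h : ∀ y ∈ U, f y = g y) : dirDeriv X f x = dirDeriv X g x := by
  have : f =ᶠ[nhds x] g := Filter.eventually_of_mem (hU.mem_nhds hx) h
  simp only [dirDeriv, this.fderiv_eq]

theorem dirDeriv_eq_zero_of_const (hU : IsOpen U) (hx : x ∈ U) {f : ℝ × ℝ → E} {c : E}
    (h : ∀ y ∈ U, f y = c) : dirDeriv X f x = 0 := by
  rw [dirDeriv_congr X hU hx (g := fun _ => c) h]
  simp [dirDeriv]

theorem dirDeriv_const (c : E) : dirDeriv X (fun _ => c) x = 0 := by
  simp [dirDeriv]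

theorem dirDeriv_add {f g : ℝ × ℝ → E} (hf : DifferentiableAt ℝ f x)
    (hg : DifferentiableAt ℝ g x) :
    dirDeriv X (fun y => f y + g y) x = dirDeriv X f x + dirDeriv X g x := by
  simp only [dirDeriv, fderiv_fun_add hf hg, add_apply]

theorem dirDeriv_sub {f g : ℝ × ℝ → E} (hf : DifferentiableAt ℝ f x)
    (hg : DifferentiableAt ℝ g x) :
    dirDeriv X (fun y => f y - g y) x = dirDeriv X f x - dirDeriv X g x := by
  simp only [dirDeriv, fderiv_fun_sub hf hg, sub_apply]

theorem dirDeriv_neg (f : ℝ × ℝ → E) :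
    dirDeriv X (fun y => -f y) x = -dirDeriv X f x := by
  simp only [dirDeriv, fderiv_fun_neg, neg_apply]

theorem dirDeriv_smul {a : ℝ × ℝ → ℝ} {f : ℝ × ℝ → E} (ha : DifferentiableAt ℝ a x)
    (hf : DifferentiableAt ℝ f x) :
    dirDeriv X (fun y => a y • f y) x = a x • dirDeriv X f x + dirDeriv X a x • f x := by
  simp only [dirDeriv, fderiv_fun_smul ha hf, add_apply,
    smul_apply, ContinuousLinearMap.smulRight_apply]

theorem dirDeriv_mul {a b : ℝ × ℝ → ℝ} (ha : DifferentiableAt ℝ a x)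
    (hb : DifferentiableAt ℝ b x) :
    dirDeriv X (fun y => a y * b y) x = a x * dirDeriv X b x + dirDeriv X a x * b x :=
  dirDeriv_smul X ha hb

theorem dirDeriv_const_smul (c : ℝ) (f : ℝ × ℝ → E) (hf : DifferentiableAt ℝ f x) :
    dirDeriv X (fun y => c • f y) x = c • dirDeriv X f x := by
  rw [dirDeriv_smul X (differentiableAt_const c) hf, dirDeriv_const, zero_smul, add_zero]

theorem dirDeriv_const_mul (c : ℝ) {f : ℝ × ℝ → ℝ} (hf : DifferentiableAt ℝ f x) :
    dirDeriv X (fun y => c * f y) x = c * dirDeriv X f x :=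
  dirDeriv_const_smul X c f hf

theorem dirDeriv_smul_const {a : ℝ × ℝ → ℝ} (ha : DifferentiableAt ℝ a x) (e : E) :
    dirDeriv X (fun y => a y • e) x = dirDeriv X a x • e := by
  rw [dirDeriv_smul X ha (differentiableAt_const e), dirDeriv_const, smul_zero, zero_add]

theorem dirDeriv_exp_two_mul {θ : ℝ × ℝ → ℝ} (hθ : DifferentiableAt ℝ θ x) :
    dirDeriv X (fun y => Real.exp (2 * θ y)) x = Real.exp (2 * θ x) * (2 * dirDeriv X θ x) := by
  have h : DifferentiableAt ℝ (fun y => 2 * θ y) x := hθ.const_mul 2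
  rw [← dirDeriv_const_mul X 2 hθ]
  simp only [dirDeriv, fderiv_exp h, smul_apply, smul_eq_mul]

theorem dirDeriv_comm (hU : IsOpen U) (hx : x ∈ U) {f : ℝ × ℝ → E} (hf : ContDiffOn ℝ ∞ f U) :
    dirDeriv X (dirDeriv Y f) x = dirDeriv Y (dirDeriv X f) x := by
  have hd : DifferentiableAt ℝ (fderiv ℝ f) x :=
    differentiableAt_of_contDiffOn hU hx (hf.fderiv_of_isOpen hU (m := ∞) (by simp))
  have hs : IsSymmSndFDerivAt ℝ f x :=
    (hf.contDiffAt (hU.mem_nhds hx)).isSymmSndFDerivAt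
      (by simpa using WithTop.coe_le_coe.2 (le_top : (2 : ℕ∞) ≤ ⊤))
  have key : ∀ X Y : ℝ × ℝ, dirDeriv X (dirDeriv Y f) x = fderiv ℝ (fderiv ℝ f) x X Y := by
    intro X Y
    change fderiv ℝ (fun y => fderiv ℝ f y Y) x X = _
    rw [fderiv_clm_apply hd (differentiableAt_const Y)]
    simp
  rw [key, key, hs.eq]

theorem du_dv_comm (hU : IsOpen U) (hx : x ∈ U) {f : ℝ × ℝ → E} (hf : ContDiffOn ℝ ∞ f U) :
    du (dv f) x = dv (du f) x := dirDeriv_comm _ _ hU hx hf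

theorem exists_const_of_du_dv_eq_zero (hU : IsOpen U) (hc : IsConnected U) {f : ℝ × ℝ → E}
    (hf : ContDiffOn ℝ ∞ f U) (h₁ : ∀ x ∈ U, du f x = 0) (h₂ : ∀ x ∈ U, dv f x = 0) :
    ∃ c, ∀ x ∈ U, f x = c := by
  refine hU.exists_is_const_of_fderiv_eq_zero hc.isPreconnected (hf.differentiableOn (by simp))
    fun x hx => ?_
  ext
  · simpa [du] using h₁ x hx
  · simpa [dv] using h₂ x hx

end Calculus

/-! ### The Lorentzian inner product -/

theorem lor_apply (x y : V) :
    lor x y = x 0 * y 0 + x 1 * y 1 + x 2 * y 2 + x 3 * y 3 - x 4 * y 4 := rfl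

theorem lor_comm (x y : V) : lor x y = lor y x := by
  simp only [lor_apply]; ring

theorem contDiffOn_lor {U : Set (ℝ × ℝ)} {f g : ℝ × ℝ → V} (hf : ContDiffOn ℝ ∞ f U)
    (hg : ContDiffOn ℝ ∞ g U) : ContDiffOn ℝ ∞ (fun y => lor (f y) (g y)) U := by
  have hf' := contDiffOn_pi.1 hf
  have hg' := contDiffOn_pi.1 hg
  have h : ∀ i, ContDiffOn ℝ ∞ (fun y => f y i * g y i) U := fun i => (hf' i).mul (hg' i)
  exact ((((h 0).add (h 1)).add (h 2)).add (h 3)).sub (h 4)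

/-- Leibniz' rule for the Lorentzian inner product. -/
theorem dirDeriv_lor (X : ℝ × ℝ) {x : ℝ × ℝ} {f g : ℝ × ℝ → V} (hf : DifferentiableAt ℝ f x)
    (hg : DifferentiableAt ℝ g x) :
    dirDeriv X (fun y => lor (f y) (g y)) x
      = lor (dirDeriv X f x) (g x) + lor (f x) (dirDeriv X g x) := by
  have hf' := differentiableAt_pi.1 hf
  have hg' := differentiableAt_pi.1 hg
  have ef : ∀ i, dirDeriv X f x i = dirDeriv X (fun y => f y i) x := fun i => by
    simp only [dirDeriv]; rw [fderiv_pi hf']; rfl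
  have eg : ∀ i, dirDeriv X g x i = dirDeriv X (fun y => g y i) x := fun i => by
    simp only [dirDeriv]; rw [fderiv_pi hg']; rfl
  have h : ∀ i, DifferentiableAt ℝ (fun y => f y i * g y i) x := fun i => (hf' i).mul (hg' i)
  simp only [lor_apply, ef, eg]
  rw [dirDeriv_sub X ((((h 0).fun_add (h 1)).fun_add (h 2)).fun_add (h 3)) (h 4),
    dirDeriv_add X (((h 0).fun_add (h 1)).fun_add (h 2)) (h 3),
    dirDeriv_add X ((h 0).fun_add (h 1)) (h 2), dirDeriv_add X (h 0) (h 1)]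
  simp only [dirDeriv_mul X (hf' _) (hg' _)]
  ring

/-- Differentiating a relation `(f, g) = c` between vector fields. -/
theorem lor_dirDeriv_eq_neg {U : Set (ℝ × ℝ)} (hU : IsOpen U) {x : ℝ × ℝ} (hx : x ∈ U)
    (X : ℝ × ℝ) {f g : ℝ × ℝ → V} (hf : ContDiffOn ℝ ∞ f U) (hg : ContDiffOn ℝ ∞ g U) {c : ℝ}
    (h : ∀ y ∈ U, lor (f y) (g y) = c) :
    lor (dirDeriv X f x) (g x) = -lor (f x) (dirDeriv X g x) := by
  have h₁ := dirDeriv_lor X (differentiableAt_of_contDiffOn hU hx hf)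
    (differentiableAt_of_contDiffOn hU hx hg)
  rw [dirDeriv_eq_zero_of_const X hU hx h] at h₁
  linarith

/-- The Gram matrix of the frame `F, F_u, F_v, N, w` at a point, in abstract form. -/
structure IsAdaptedFrame (E s : ℝ) (f a b n w : V) : Prop where
  pos : 0 < E
  ff : lor f f = 0
  fa : lor f a = 0
  fb : lor f b = 0
  fn : lor f n = 0
  fw : lor f w = -1
  aa : lor a a = E
  ab : lor a b = 0
  an : lor a n = 0
  aw : lor a w = 0
  bb : lor b b = E
  bn : lor b n = 0
  bw : lor b w = 0
  nn : lor n n = 1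
  nw : lor n w = 0
  ww : lor w w = s

namespace IsAdaptedFrame

variable {E s : ℝ} {f a b n w : V} (h : IsAdaptedFrame E s f a b n w)
include h

/-- Inner products of a linear combination of the frame with the vectors of the frame. -/
theorem lor_combination (x₀ x₁ x₂ x₃ x₄ : ℝ) :
    lor (x₀ • f + x₁ • a + x₂ • b + x₃ • n + x₄ • w) f = -x₄ ∧
    lor (x₀ • f + x₁ • a + x₂ • b + x₃ • n + x₄ • w) a = E * x₁ ∧
    lor (x₀ • f + x₁ • a + x₂ • b + x₃ • n + x₄ • w) b = E * x₂ ∧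
    lor (x₀ • f + x₁ • a + x₂ • b + x₃ • n + x₄ • w) n = x₃ ∧
    lor (x₀ • f + x₁ • a + x₂ • b + x₃ • n + x₄ • w) w = -x₀ + s * x₄ := by
  simp only [map_add, map_smul, LinearMap.add_apply, LinearMap.smul_apply, smul_eq_mul,
    lor_comm a f, lor_comm b f, lor_comm n f, lor_comm w f, lor_comm b a, lor_comm n a,
    lor_comm w a, lor_comm n b, lor_comm w b, lor_comm w n, h.ff, h.fa, h.fb, h.fn, h.fw, h.aa,
    h.ab, h.an, h.aw, h.bb, h.bn, h.bw, h.nn, h.nw, h.ww]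
  refine ⟨?_, ?_, ?_, ?_, ?_⟩ <;> ring

theorem coeff_eq_zero {x₀ x₁ x₂ x₃ x₄ : ℝ}
    (h₀ : x₀ • f + x₁ • a + x₂ • b + x₃ • n + x₄ • w = 0) :
    x₀ = 0 ∧ x₁ = 0 ∧ x₂ = 0 ∧ x₃ = 0 ∧ x₄ = 0 := by
  have hE := h.pos.ne'
  obtain ⟨h₁, h₂, h₃, h₄, h₅⟩ := h.lor_combination x₀ x₁ x₂ x₃ x₄
  simp only [h₀, map_zero, LinearMap.zero_apply] at h₁ h₂ h₃ h₄ h₅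
  have e₄ : x₄ = 0 := by linarith
  refine ⟨by rw [e₄] at h₅; linarith, ?_, ?_, h₄.symm, e₄⟩
  · exact (mul_eq_zero.1 h₂.symm).resolve_left hE
  · exact (mul_eq_zero.1 h₃.symm).resolve_left hE

/-- The frame is a basis of `ℝ^{4,1}`, and inner products determine the coefficients. -/
theorem expansion (x : V) :
    x = (-lor x w - s * lor x f) • f + (lor x a / E) • a + (lor x b / E) • b + lor x n • n
      + (-lor x f) • w := by
  have hE := h.pos.ne'
  have hli : LinearIndependent ℝ ![f, a, b, n, w] := by
    rw [Fintype.linearIndependent_iff]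
    intro g hg
    simp only [Fin.sum_univ_five, Matrix.cons_val] at hg
    obtain ⟨h₁, h₂, h₃, h₄, h₅⟩ := h.coeff_eq_zero hg
    intro i
    fin_cases i <;> assumption
  have hspan := hli.span_eq_top_of_card_eq_finrank (by simp)
  have hx : x ∈ Submodule.span ℝ (Set.range ![f, a, b, n, w]) := by rw [hspan]; trivial
  obtain ⟨c, hc⟩ := (Submodule.mem_span_range_iff_exists_fun ℝ).1 hx
  simp only [Fin.sum_univ_five, Matrix.cons_val] at hc
  obtain ⟨h₁, h₂, h₃, h₄, h₅⟩ := h.lor_combination (c 0) (c 1) (c 2) (c 3) (c 4)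
  rw [hc] at h₁ h₂ h₃ h₄ h₅
  rw [h₁, h₂, h₃, h₄, h₅, mul_div_cancel_left₀ _ hE, mul_div_cancel_left₀ _ hE]
  conv_lhs => rw [← hc]
  module

end IsAdaptedFrame

/-! ### Skew endomorphisms in `S ∧ S^⊥` -/

theorem wedge_apply (a b x : V) : wedge a b x = lor a x • b - lor b x • a := rfl

theorem lor_skew_of_mem_wedgePerp {S : Submodule ℝ V} {T : V →L[ℝ] V} (hT : T ∈ wedgePerp S)
    (x y : V) : lor (T x) y = -lor x (T y) := by
  induction hT using Submodule.span_induction with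
  | mem T h =>
    obtain ⟨a, -, b, -, rfl⟩ := h
    simp only [wedge_apply, map_sub, map_smul, LinearMap.sub_apply, LinearMap.smul_apply,
      smul_eq_mul, lor_comm x]
    ring
  | zero => simp
  | add T T' _ _ h h' =>
    simp only [add_apply, map_add, LinearMap.add_apply, h, h']
    ring
  | smul c T _ h =>
    simp only [smul_apply, map_smul, LinearMap.smul_apply, h, smul_eq_mul]
    ring

theorem apply_eq_zero_of_mem_wedgePerp {f : V} (hf : lor f f = 0) {T : V →L[ℝ] V}
    (hT : T ∈ wedgePerp (Submodule.span ℝ {f})) : T f = 0 := by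
  induction hT using Submodule.span_induction with
  | mem T h =>
    obtain ⟨a, ha, b, hb, rfl⟩ := h
    obtain ⟨c, rfl⟩ := Submodule.mem_span_singleton.1 ha
    rw [wedge_apply, lor_comm b, hb f (Submodule.mem_span_singleton_self f)]
    simp [hf]
  | zero => simp
  | add T T' _ _ h h' => simp [h, h']
  | smul c T _ h => simp [h]

/-! ### The moving frame of a surface in curvature line coordinates -/

/-- The frame `F, F_u, F_v, N, w` along a surface in `E(w)` in conformal curvature line
coordinates: its Gram matrix, the Gauss equations for the second derivatives of `F` and the
Weingarten equations for the derivatives of `N`. -/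
structure IsCurvatureLineFrame (U : Set (ℝ × ℝ)) (w : V) (F N : ℝ × ℝ → V)
    (θ k₁ k₂ : ℝ × ℝ → ℝ) : Prop where
  isOpen : IsOpen U
  smooth_F : ContDiffOn ℝ ∞ F U
  smooth_N : ContDiffOn ℝ ∞ N U
  smooth_θ : ContDiffOn ℝ ∞ θ U
  smooth_k₁ : ContDiffOn ℝ ∞ k₁ U
  smooth_k₂ : ContDiffOn ℝ ∞ k₂ U
  adapted : ∀ x ∈ U, IsAdaptedFrame (Real.exp (2 * θ x)) (lor w w) (F x) (du F x) (dv F x) (N x) w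
  du_du : ∀ x ∈ U, du (du F) x = du θ x • du F x - dv θ x • dv F x
    + (Real.exp (2 * θ x) * k₁ x) • N x + Real.exp (2 * θ x) • (lor w w • F x + w)
  dv_du : ∀ x ∈ U, dv (du F) x = dv θ x • du F x + du θ x • dv F x
  dv_dv : ∀ x ∈ U, dv (dv F) x = dv θ x • dv F x - du θ x • du F x
    + (Real.exp (2 * θ x) * k₂ x) • N x + Real.exp (2 * θ x) • (lor w w • F x + w)
  du_N : ∀ x ∈ U, du N x = -(k₁ x • du F x)
  dv_N : ∀ x ∈ U, dv N x = -(k₂ x • dv F x)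

theorem IsConformalCurvatureLine.isCurvatureLineFrame {U : Set (ℝ × ℝ)} (hU : IsOpen U) {w : V}
    {F N : ℝ × ℝ → V} {θ k₁ k₂ : ℝ × ℝ → ℝ} (hF : ContDiffOn ℝ ∞ F U)
    (hFw : ∀ x ∈ U, F x ∈ spaceForm w) (hN : IsUnitNormal U w F N)
    (hcoord : IsConformalCurvatureLine U F N θ k₁ k₂) :
    IsCurvatureLineFrame U w F N θ k₁ k₂ := by
  have hdu := contDiffOn_du hU hF
  have hdv := contDiffOn_dv hU hF
  have hNs := hN.smooth
  have hws : ContDiffOn ℝ ∞ (fun _ : ℝ × ℝ => w) U := contDiffOn_const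
  have hI : ∀ x ∈ U, lor (du F x) (du F x) = Real.exp (2 * θ x) ∧ lor (du F x) (dv F x) = 0 ∧
      lor (dv F x) (dv F x) = Real.exp (2 * θ x) := fun x hx =>
    ⟨(hcoord x hx (1, 0) (1, 0)).1.trans (by simp),
      (hcoord x hx (1, 0) (0, 1)).1.trans (by simp),
      (hcoord x hx (0, 1) (0, 1)).1.trans (by simp)⟩
  have hII : ∀ x ∈ U, lor (du (du F) x) (N x) = Real.exp (2 * θ x) * k₁ x ∧
      lor (dv (du F) x) (N x) = 0 ∧ lor (dv (dv F) x) (N x) = Real.exp (2 * θ x) * k₂ x :=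
    fun x hx =>
    ⟨(hcoord x hx (1, 0) (1, 0)).2.trans (by simp),
      (hcoord x hx (0, 1) (1, 0)).2.trans (by simp),
      (hcoord x hx (0, 1) (0, 1)).2.trans (by simp)⟩
  have hθ : ContDiffOn ℝ ∞ θ U := by
    have h := ((contDiffOn_lor hdu hdu).log fun x hx => by
      rw [(hI x hx).1]; exact (Real.exp_pos _).ne').div_const 2
    refine h.congr fun x hx => ?_
    rw [(hI x hx).1, Real.log_exp]
    ring
  have hexp : ContDiffOn ℝ ∞ (fun x => Real.exp (2 * θ x)) U := (contDiffOn_const.mul hθ).exp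
  have hk₁ : ContDiffOn ℝ ∞ k₁ U := by
    refine ((contDiffOn_lor (contDiffOn_du hU hdu) hNs).div hexp
      fun x _ => (Real.exp_pos _).ne').congr fun x hx => ?_
    rw [Pi.div_apply, (hII x hx).1, mul_div_cancel_left₀ _ (Real.exp_pos _).ne']
  have hk₂ : ContDiffOn ℝ ∞ k₂ U := by
    refine ((contDiffOn_lor (contDiffOn_dv hU hdv) hNs).div hexp
      fun x _ => (Real.exp_pos _).ne').congr fun x hx => ?_
    rw [Pi.div_apply, (hII x hx).2.2, mul_div_cancel_left₀ _ (Real.exp_pos _).ne']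
  have hFF : ∀ x ∈ U, lor (F x) (F x) = 0 := fun x hx => (hFw x hx).1.2
  have hFw' : ∀ x ∈ U, lor (F x) w = -1 := fun x hx => (hFw x hx).2
  have hFX : ∀ X, ∀ x ∈ U, lor (dirDeriv X F x) (F x) = 0 := fun X x hx => by
    have h := lor_dirDeriv_eq_neg hU hx X hF hF hFF
    rw [lor_comm (F x)] at h
    linarith
  have hXw : ∀ X, ∀ x ∈ U, lor (dirDeriv X F x) w = 0 := fun X x hx => by
    have h := lor_dirDeriv_eq_neg hU hx X hF hws hFw'
    rwa [dirDeriv_const, map_zero, neg_zero] at h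
  have hXN : ∀ X, ∀ x ∈ U, lor (dirDeriv X F x) (N x) = 0 := fun X x hx => by
    rw [lor_comm]; exact hN.normal x hx X
  have hadapted : ∀ x ∈ U,
      IsAdaptedFrame (Real.exp (2 * θ x)) (lor w w) (F x) (du F x) (dv F x) (N x) w := fun x hx =>
    { pos := Real.exp_pos _
      ff := hFF x hx
      fa := by rw [lor_comm]; exact hFX _ x hx
      fb := by rw [lor_comm]; exact hFX _ x hx
      fn := by rw [lor_comm]; exact (hN.tangent x hx).1
      fw := hFw' x hx
      aa := (hI x hx).1
      ab := (hI x hx).2.1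
      an := hXN _ x hx
      aw := hXw _ x hx
      bb := (hI x hx).2.2
      bn := hXN _ x hx
      bw := hXw _ x hx
      nn := hN.unit x hx
      nw := (hN.tangent x hx).2
      ww := rfl }
  have hs : ∀ X, ContDiffOn ℝ ∞ (dirDeriv X F) U := fun X => contDiffOn_dirDeriv X hU hF
  -- second derivatives of `F` paired with `F` and `w`
  have hXYF : ∀ X Y, ∀ x ∈ U,
      lor (dirDeriv X (dirDeriv Y F) x) (F x) = -lor (dirDeriv Y F x) (dirDeriv X F x) :=
    fun X Y x hx => lor_dirDeriv_eq_neg hU hx X (hs Y) hF (hFX Y)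
  have hXYw : ∀ X Y, ∀ x ∈ U, lor (dirDeriv X (dirDeriv Y F) x) w = 0 := fun X Y x hx => by
    have h := lor_dirDeriv_eq_neg hU hx X (hs Y) hws (hXw Y)
    rwa [dirDeriv_const, map_zero, neg_zero] at h
  -- the derivatives of the first fundamental form
  have hE : ∀ X Y, (∀ x ∈ U, lor (dirDeriv Y F x) (dirDeriv Y F x) = Real.exp (2 * θ x)) →
      ∀ x ∈ U, lor (dirDeriv X (dirDeriv Y F) x) (dirDeriv Y F x)
        = Real.exp (2 * θ x) * dirDeriv X θ x := fun X Y hY x hx => by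
    have hd := differentiableAt_of_contDiffOn hU hx (hs Y)
    have h := dirDeriv_lor X hd hd
    rw [dirDeriv_congr X hU hx hY,
      dirDeriv_exp_two_mul X (differentiableAt_of_contDiffOn hU hx hθ),
      lor_comm (dirDeriv Y F x)] at h
    linarith
  have hEuu := hE (1, 0) (1, 0) fun x hx => (hI x hx).1
  have hEvu := hE (0, 1) (1, 0) fun x hx => (hI x hx).1
  have hEuv := hE (1, 0) (0, 1) fun x hx => (hI x hx).2.2
  have hEvv := hE (0, 1) (0, 1) fun x hx => (hI x hx).2.2
  have hG : ∀ X, ∀ x ∈ U, lor (dirDeriv X (dirDeriv (1, 0) F) x) (dirDeriv (0, 1) F x)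
      = -lor (dirDeriv (1, 0) F x) (dirDeriv X (dirDeriv (0, 1) F) x) := fun X x hx =>
    lor_dirDeriv_eq_neg hU hx X (hs _) (hs _) fun y hy => (hI y hy).2.1
  have hNN : ∀ X, ∀ x ∈ U, lor (dirDeriv X N x) (N x) = 0 := fun X x hx => by
    have h := lor_dirDeriv_eq_neg hU hx X hNs hNs hN.unit
    rw [lor_comm (N x)] at h
    linarith
  have hNF : ∀ X, ∀ x ∈ U, lor (dirDeriv X N x) (F x) = 0 := fun X x hx => by
    have h := lor_dirDeriv_eq_neg hU hx X hNs hF fun y hy => (hN.tangent y hy).1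
    rw [h, lor_comm, hXN X x hx, neg_zero]
  have hNw : ∀ X, ∀ x ∈ U, lor (dirDeriv X N x) w = 0 := fun X x hx => by
    have h := lor_dirDeriv_eq_neg hU hx X hNs hws fun y hy => (hN.tangent y hy).2
    rwa [dirDeriv_const, map_zero, neg_zero] at h
  have hNXY : ∀ X Y, ∀ x ∈ U, lor (dirDeriv X N x) (dirDeriv Y F x)
      = -lor (dirDeriv X (dirDeriv Y F) x) (N x) := fun X Y x hx => by
    rw [lor_comm (dirDeriv X (dirDeriv Y F) x)]
    exact lor_dirDeriv_eq_neg hU hx X hNs (hs Y) fun y hy => hN.normal y hy Y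
  refine ⟨hU, hF, hNs, hθ, hk₁, hk₂, hadapted, fun x hx => ?_, fun x hx => ?_, fun x hx => ?_,
    fun x hx => ?_, fun x hx => ?_⟩ <;> have hne := (Real.exp_pos (2 * θ x)).ne'
  · have e := (hadapted x hx).expansion (du (du F) x)
    have e₃ := (hII x hx).1
    have e₄ := (hI x hx).1
    have e₅ := hG (1, 0) x hx
    rw [dirDeriv_comm (1, 0) (0, 1) hU hx hF, lor_comm (dirDeriv (1, 0) F x), hEvu x hx] at e₅
    simp only [du_eq_dirDeriv, dv_eq_dirDeriv] at e e₃ e₄ ⊢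
    rw [hXYF _ _ x hx, hXYw _ _ x hx, hEuu x hx, e₅, e₃, e₄, mul_div_cancel_left₀ _ hne,
      neg_div, mul_div_cancel_left₀ _ hne] at e
    rw [e]
    module
  · have e := (hadapted x hx).expansion (dv (du F) x)
    have e₃ := (hII x hx).2.1
    have e₄ := (hI x hx).2.1
    have e₅ := hEuv x hx
    rw [dirDeriv_comm _ _ hU hx hF] at e₅
    simp only [du_eq_dirDeriv, dv_eq_dirDeriv] at e e₃ e₄ ⊢
    rw [hXYF _ _ x hx, hXYw _ _ x hx, hEvu x hx, e₅, e₃, e₄, mul_div_cancel_left₀ _ hne,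
      mul_div_cancel_left₀ _ hne] at e
    rw [e]
    module
  · have e := (hadapted x hx).expansion (dv (dv F) x)
    have e₃ := (hII x hx).2.2
    have e₄ := (hI x hx).2.2
    have e₅ := hG (0, 1) x hx
    rw [dirDeriv_comm _ _ hU hx hF, hEuv x hx, lor_comm (dirDeriv (1, 0) F x)] at e₅
    simp only [du_eq_dirDeriv, dv_eq_dirDeriv] at e e₃ e₄ ⊢
    rw [hXYF _ _ x hx, hXYw _ _ x hx, hEvv x hx, ← neg_eq_iff_eq_neg.2 e₅, e₃, e₄,
      mul_div_cancel_left₀ _ hne, neg_div, mul_div_cancel_left₀ _ hne] at e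
    rw [e]
    module
  · have e := (hadapted x hx).expansion (du N x)
    have e₃ := (hII x hx).1
    have e₄ := (hII x hx).2.1
    simp only [du_eq_dirDeriv, dv_eq_dirDeriv] at e e₃ e₄ ⊢
    rw [dirDeriv_comm _ _ hU hx hF] at e₄
    rw [hNF _ x hx, hNw _ x hx, hNN _ x hx, hNXY _ _ x hx, hNXY _ _ x hx, e₃, e₄, neg_div,
      mul_div_cancel_left₀ _ hne] at e
    rw [e]
    module
  · have e := (hadapted x hx).expansion (dv N x)
    have e₃ := (hII x hx).2.2
    have e₄ := (hII x hx).2.1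
    simp only [du_eq_dirDeriv, dv_eq_dirDeriv] at e e₃ e₄ ⊢
    rw [hNF _ x hx, hNw _ x hx, hNN _ x hx, hNXY _ _ x hx, hNXY _ _ x hx, e₃, e₄, neg_zero,
      zero_div, neg_div, mul_div_cancel_left₀ _ hne] at e
    rw [e]
    module

/-! ### Codazzi equations and their consequences for `H`, `L` and `M` -/

namespace IsCurvatureLineFrame

variable {U : Set (ℝ × ℝ)} {w : V} {F N : ℝ × ℝ → V} {θ k₁ k₂ : ℝ × ℝ → ℝ}
  (h : IsCurvatureLineFrame U w F N θ k₁ k₂) {x : ℝ × ℝ}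
include h

/-- The Codazzi equations, from `N_uv = N_vu`. -/
theorem codazzi (hx : x ∈ U) :
    dv k₁ x = (k₂ x - k₁ x) * dv θ x ∧ du k₂ x = (k₁ x - k₂ x) * du θ x := by
  have hdF := differentiableAt_of_contDiffOn h.isOpen hx (contDiffOn_du h.isOpen h.smooth_F)
  have hdF' := differentiableAt_of_contDiffOn h.isOpen hx (contDiffOn_dv h.isOpen h.smooth_F)
  have hk₁ := differentiableAt_of_contDiffOn h.isOpen hx h.smooth_k₁
  have hk₂ := differentiableAt_of_contDiffOn h.isOpen hx h.smooth_k₂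
  have e := du_dv_comm h.isOpen hx h.smooth_N
  rw [du_eq_dirDeriv, dv_eq_dirDeriv (du N), dirDeriv_congr _ h.isOpen hx h.dv_N,
    dirDeriv_congr _ h.isOpen hx h.du_N, dirDeriv_neg, dirDeriv_neg, dirDeriv_smul _ hk₂ hdF',
    dirDeriv_smul _ hk₁ hdF] at e
  simp only [← du_eq_dirDeriv, ← dv_eq_dirDeriv] at e
  rw [du_dv_comm h.isOpen hx h.smooth_F, h.dv_du x hx] at e
  have := (h.adapted x hx).coeff_eq_zero
    (x₀ := 0) (x₁ := dv k₁ x + (k₁ x - k₂ x) * dv θ x) (x₂ := (k₁ x - k₂ x) * du θ x - du k₂ x)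
    (x₃ := 0) (x₄ := 0) (by linear_combination (norm := module) e)
  exact ⟨by linarith [this.2.1], by linarith [this.2.2.1]⟩

theorem smooth_exp : ContDiffOn ℝ ∞ (fun x => Real.exp (2 * θ x)) U :=
  (contDiffOn_const.mul h.smooth_θ).exp

theorem smooth_meanCurv : ContDiffOn ℝ ∞ (meanCurv k₁ k₂) U :=
  (h.smooth_k₁.add h.smooth_k₂).div_const 2

theorem smooth_fnL : ContDiffOn ℝ ∞ (fnL θ k₁ k₂) U :=
  h.smooth_exp.mul (h.smooth_k₁.sub h.smooth_k₂)

theorem smooth_fnM : ContDiffOn ℝ ∞ (fnM θ k₁ k₂) U :=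
  (h.smooth_meanCurv.mul h.smooth_fnL).neg

theorem dirDeriv_meanCurv (X : ℝ × ℝ) (hx : x ∈ U) :
    dirDeriv X (meanCurv k₁ k₂) x = (dirDeriv X k₁ x + dirDeriv X k₂ x) / 2 := by
  have hk₁ := differentiableAt_of_contDiffOn h.isOpen hx h.smooth_k₁
  have hk₂ := differentiableAt_of_contDiffOn h.isOpen hx h.smooth_k₂
  rw [← dirDeriv_add X hk₁ hk₂,
    dirDeriv_congr X h.isOpen hx (g := fun y => (1 / 2 : ℝ) * (k₁ y + k₂ y))
      fun y _ => by rw [meanCurv]; ring,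
    dirDeriv_const_mul X _ (hk₁.fun_add hk₂)]
  ring

theorem dirDeriv_fnL (X : ℝ × ℝ) (hx : x ∈ U) :
    dirDeriv X (fnL θ k₁ k₂) x = Real.exp (2 * θ x) *
      (2 * dirDeriv X θ x * (k₁ x - k₂ x) + (dirDeriv X k₁ x - dirDeriv X k₂ x)) := by
  have hk₁ := differentiableAt_of_contDiffOn h.isOpen hx h.smooth_k₁
  have hk₂ := differentiableAt_of_contDiffOn h.isOpen hx h.smooth_k₂
  have hθ := differentiableAt_of_contDiffOn h.isOpen hx h.smooth_θ
  have hE := differentiableAt_of_contDiffOn h.isOpen hx h.smooth_exp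
  have e : dirDeriv X (fnL θ k₁ k₂) x = _ := dirDeriv_mul X hE (hk₁.fun_sub hk₂)
  rw [e, dirDeriv_exp_two_mul X hθ, dirDeriv_sub X hk₁ hk₂]
  ring

theorem dirDeriv_fnM (X : ℝ × ℝ) (hx : x ∈ U) :
    dirDeriv X (fnM θ k₁ k₂) x = -(meanCurv k₁ k₂ x * dirDeriv X (fnL θ k₁ k₂) x
      + dirDeriv X (meanCurv k₁ k₂) x * fnL θ k₁ k₂ x) := by
  have hH := differentiableAt_of_contDiffOn h.isOpen hx h.smooth_meanCurv
  have hL := differentiableAt_of_contDiffOn h.isOpen hx h.smooth_fnL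
  have e : dirDeriv X (fnM θ k₁ k₂) x = _ := dirDeriv_neg X _
  rw [e, dirDeriv_mul X hH hL]

theorem du_fnL (hx : x ∈ U) :
    du (fnL θ k₁ k₂) x = 2 * Real.exp (2 * θ x) * du (meanCurv k₁ k₂) x := by
  have hc := (h.codazzi hx).2
  rw [du_eq_dirDeriv] at hc
  rw [du_eq_dirDeriv, du_eq_dirDeriv, h.dirDeriv_fnL _ hx, h.dirDeriv_meanCurv _ hx, hc,
    du_eq_dirDeriv]
  ring

theorem dv_fnL (hx : x ∈ U) :
    dv (fnL θ k₁ k₂) x = -(2 * Real.exp (2 * θ x) * dv (meanCurv k₁ k₂) x) := by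
  have hc := (h.codazzi hx).1
  rw [dv_eq_dirDeriv] at hc
  rw [dv_eq_dirDeriv, dv_eq_dirDeriv, h.dirDeriv_fnL _ hx, h.dirDeriv_meanCurv _ hx, hc,
    dv_eq_dirDeriv]
  ring

theorem du_fnM (hx : x ∈ U) :
    du (fnM θ k₁ k₂) x = -(2 * Real.exp (2 * θ x) * k₁ x * du (meanCurv k₁ k₂) x) := by
  have e := h.du_fnL hx
  simp only [du_eq_dirDeriv] at e ⊢
  rw [h.dirDeriv_fnM _ hx, e, meanCurv, fnL]
  ring

theorem dv_fnM (hx : x ∈ U) :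
    dv (fnM θ k₁ k₂) x = 2 * Real.exp (2 * θ x) * k₂ x * dv (meanCurv k₁ k₂) x := by
  have e := h.dv_fnL hx
  simp only [dv_eq_dirDeriv] at e ⊢
  rw [h.dirDeriv_fnM _ hx, e, meanCurv, fnL]
  ring

/-- The mixed second derivative of the mean curvature, from `L_uv = L_vu`. -/
theorem dv_du_meanCurv (hx : x ∈ U) :
    dv (du (meanCurv k₁ k₂)) x
      = -(dv θ x * du (meanCurv k₁ k₂) x + du θ x * dv (meanCurv k₁ k₂) x) := by
  have hHu := differentiableAt_of_contDiffOn h.isOpen hx (contDiffOn_du h.isOpen h.smooth_meanCurv)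
  have hHv := differentiableAt_of_contDiffOn h.isOpen hx (contDiffOn_dv h.isOpen h.smooth_meanCurv)
  have hθ := differentiableAt_of_contDiffOn h.isOpen hx h.smooth_θ
  have hE := differentiableAt_of_contDiffOn h.isOpen hx h.smooth_exp
  have e := du_dv_comm h.isOpen hx h.smooth_fnL
  rw [du_eq_dirDeriv, dv_eq_dirDeriv (du _),
    dirDeriv_congr _ h.isOpen hx fun y hy => h.dv_fnL hy,
    dirDeriv_congr _ h.isOpen hx fun y hy => h.du_fnL hy, dirDeriv_neg,
    dirDeriv_mul _ (hE.const_mul 2) hHv, dirDeriv_mul _ (hE.const_mul 2) hHu,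
    dirDeriv_const_mul _ _ hE, dirDeriv_const_mul _ _ hE, dirDeriv_exp_two_mul _ hθ,
    dirDeriv_exp_two_mul _ hθ] at e
  simp only [← du_eq_dirDeriv, ← dv_eq_dirDeriv] at e
  rw [du_dv_comm h.isOpen hx h.smooth_meanCurv] at e
  refine mul_left_cancel₀ (Real.exp_pos (2 * θ x)).ne' ?_
  linarith

end IsCurvatureLineFrame

/-! ### The linear coefficient and its derivatives -/

/-- The section `φ F - H_u F_u + H_v F_v + ν N + ½ L w`. The linear coefficient of a quadratic
conserved quantity is a constant multiple of such a section. -/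
noncomputable def linearCoeff (w : V) (F N : ℝ × ℝ → V) (θ k₁ k₂ φ ν : ℝ × ℝ → ℝ) (x : ℝ × ℝ) :
    V :=
  φ x • F x - du (meanCurv k₁ k₂) x • du F x + dv (meanCurv k₁ k₂) x • dv F x + ν x • N x
    + (1 / 2 * fnL θ k₁ k₂ x) • w

namespace IsCurvatureLineFrame

variable {U : Set (ℝ × ℝ)} {w : V} {F N : ℝ × ℝ → V} {θ k₁ k₂ φ ν : ℝ × ℝ → ℝ}
  (h : IsCurvatureLineFrame U w F N θ k₁ k₂) {x : ℝ × ℝ}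
include h

theorem smooth_linearCoeff (hφ : ContDiffOn ℝ ∞ φ U) (hν : ContDiffOn ℝ ∞ ν U) :
    ContDiffOn ℝ ∞ (linearCoeff w F N θ k₁ k₂ φ ν) U :=
  ((((hφ.smul h.smooth_F).sub ((contDiffOn_du h.isOpen h.smooth_meanCurv).smul
    (contDiffOn_du h.isOpen h.smooth_F))).add ((contDiffOn_dv h.isOpen h.smooth_meanCurv).smul
    (contDiffOn_dv h.isOpen h.smooth_F))).add (hν.smul h.smooth_N)).add
    ((contDiffOn_const.mul h.smooth_fnL).smul contDiffOn_const)

theorem dirDeriv_linearCoeff (X : ℝ × ℝ) (hφ : ContDiffOn ℝ ∞ φ U) (hν : ContDiffOn ℝ ∞ ν U)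
    (hx : x ∈ U) :
    dirDeriv X (linearCoeff w F N θ k₁ k₂ φ ν) x
      = (φ x • dirDeriv X F x + dirDeriv X φ x • F x)
      - (du (meanCurv k₁ k₂) x • dirDeriv X (du F) x
        + dirDeriv X (du (meanCurv k₁ k₂)) x • du F x)
      + (dv (meanCurv k₁ k₂) x • dirDeriv X (dv F) x
        + dirDeriv X (dv (meanCurv k₁ k₂)) x • dv F x)
      + (ν x • dirDeriv X N x + dirDeriv X ν x • N x)
      + (1 / 2 * dirDeriv X (fnL θ k₁ k₂) x) • w := by
  have hφ' := differentiableAt_of_contDiffOn h.isOpen hx hφ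
  have hν' := differentiableAt_of_contDiffOn h.isOpen hx hν
  have hF := differentiableAt_of_contDiffOn h.isOpen hx h.smooth_F
  have hN := differentiableAt_of_contDiffOn h.isOpen hx h.smooth_N
  have hL := differentiableAt_of_contDiffOn h.isOpen hx h.smooth_fnL
  have hFu := differentiableAt_of_contDiffOn h.isOpen hx (contDiffOn_du h.isOpen h.smooth_F)
  have hFv := differentiableAt_of_contDiffOn h.isOpen hx (contDiffOn_dv h.isOpen h.smooth_F)
  have hHu := differentiableAt_of_contDiffOn h.isOpen hx (contDiffOn_du h.isOpen h.smooth_meanCurv)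
  have hHv := differentiableAt_of_contDiffOn h.isOpen hx (contDiffOn_dv h.isOpen h.smooth_meanCurv)
  have d₁ := hφ'.fun_smul hF
  have d₂ := hHu.fun_smul hFu
  have d₃ := hHv.fun_smul hFv
  have d₄ := hν'.fun_smul hN
  have d₅ : DifferentiableAt ℝ (fun y => 1 / 2 * fnL θ k₁ k₂ y) x := hL.const_mul _
  have d₆ : DifferentiableAt ℝ (fun y => (1 / 2 * fnL θ k₁ k₂ y) • w) x := d₅.smul_const w
  change dirDeriv X (fun y => φ y • F y - du (meanCurv k₁ k₂) y • du F y
    + dv (meanCurv k₁ k₂) y • dv F y + ν y • N y + (1 / 2 * fnL θ k₁ k₂ y) • w) x = _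
  rw [dirDeriv_add X (((d₁.fun_sub d₂).fun_add d₃).fun_add d₄) d₆,
    dirDeriv_add X ((d₁.fun_sub d₂).fun_add d₃) d₄, dirDeriv_add X (d₁.fun_sub d₂) d₃,
    dirDeriv_sub X d₁ d₂, dirDeriv_smul X hφ' hF, dirDeriv_smul X hHu hFu,
    dirDeriv_smul X hHv hFv, dirDeriv_smul X hν' hN, dirDeriv_smul_const X d₅,
    dirDeriv_const_mul X _ hL]

/-- By the Codazzi equations the `F_v`- and `w`-components of the `u`-derivative vanish. -/
theorem du_linearCoeff (hφ : ContDiffOn ℝ ∞ φ U) (hν : ContDiffOn ℝ ∞ ν U) (hx : x ∈ U) :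
    du (linearCoeff w F N θ k₁ k₂ φ ν) x
      = (du φ x - Real.exp (2 * θ x) * lor w w * du (meanCurv k₁ k₂) x) • F x
      + (φ x - du (du (meanCurv k₁ k₂)) x - du θ x * du (meanCurv k₁ k₂) x
        + dv θ x * dv (meanCurv k₁ k₂) x - ν x * k₁ x) • du F x
      + (du ν x - Real.exp (2 * θ x) * k₁ x * du (meanCurv k₁ k₂) x) • N x := by
  have e := h.dirDeriv_linearCoeff (1, 0) hφ hν hx
  simp only [← du_eq_dirDeriv] at e
  rw [e, du_dv_comm h.isOpen hx h.smooth_F, du_dv_comm h.isOpen hx h.smooth_meanCurv,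
    h.du_du x hx, h.dv_du x hx, h.du_N x hx, h.du_fnL hx, h.dv_du_meanCurv hx]
  module

/-- By the Codazzi equations the `F_u`- and `w`-components of the `v`-derivative vanish. -/
theorem dv_linearCoeff (hφ : ContDiffOn ℝ ∞ φ U) (hν : ContDiffOn ℝ ∞ ν U) (hx : x ∈ U) :
    dv (linearCoeff w F N θ k₁ k₂ φ ν) x
      = (dv φ x + Real.exp (2 * θ x) * lor w w * dv (meanCurv k₁ k₂) x) • F x
      + (φ x + dv (dv (meanCurv k₁ k₂)) x - du θ x * du (meanCurv k₁ k₂) x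
        + dv θ x * dv (meanCurv k₁ k₂) x - ν x * k₂ x) • dv F x
      + (dv ν x + Real.exp (2 * θ x) * k₂ x * dv (meanCurv k₁ k₂) x) • N x := by
  have e := h.dirDeriv_linearCoeff (0, 1) hφ hν hx
  simp only [← dv_eq_dirDeriv] at e
  rw [e, h.dv_du x hx, h.dv_dv x hx, h.dv_N x hx, h.dv_fnL hx, h.dv_du_meanCurv hx]
  module

end IsCurvatureLineFrame

/-! ### The closed one-form in the moving frame -/

/-- The values on the frame `F, F_u, F_v, N, w` of the one-form
`η = e^{-2θ} F ∧ (-F_u du + F_v dv)`. -/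
structure IsFrameForm (U : Set (ℝ × ℝ)) (η : ℝ × ℝ → (ℝ × ℝ →L[ℝ] V →L[ℝ] V)) (w : V)
    (F N : ℝ × ℝ → V) (θ : ℝ × ℝ → ℝ) : Prop where
  apply_F : ∀ x ∈ U, ∀ X, η x X (F x) = 0
  apply_du : ∀ x ∈ U, ∀ X, η x X (du F x) = X.1 • F x
  apply_dv : ∀ x ∈ U, ∀ X, η x X (dv F x) = -(X.2 • F x)
  apply_N : ∀ x ∈ U, ∀ X, η x X (N x) = 0
  apply_w : ∀ x ∈ U, ∀ X, η x X w = Real.exp (-2 * θ x) • (X.1 • du F x - X.2 • dv F x)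

theorem exp_neg_two_mul (a : ℝ) : Real.exp (-2 * a) = (Real.exp (2 * a))⁻¹ := by
  rw [← Real.exp_neg]; ring_nf

theorem IsFrameForm.apply_combination {U : Set (ℝ × ℝ)} {η : ℝ × ℝ → (ℝ × ℝ →L[ℝ] V →L[ℝ] V)}
    {w : V} {F N : ℝ × ℝ → V} {θ : ℝ × ℝ → ℝ} (h : IsFrameForm U η w F N θ) {x : ℝ × ℝ}
    (hx : x ∈ U) (X : ℝ × ℝ) (x₀ x₁ x₂ x₃ x₄ : ℝ) :
    η x X (x₀ • F x + x₁ • du F x + x₂ • dv F x + x₃ • N x + x₄ • w)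
      = (X.1 * x₁ - X.2 * x₂) • F x
        + (x₄ * Real.exp (-2 * θ x)) • (X.1 • du F x - X.2 • dv F x) := by
  simp only [map_add, map_smul, h.apply_F x hx, h.apply_du x hx, h.apply_dv x hx, h.apply_N x hx,
    h.apply_w x hx]
  module

section

variable {U : Set (ℝ × ℝ)} {w : V} {F N : ℝ × ℝ → V} {θ k₁ k₂ : ℝ × ℝ → ℝ}
  {Λ : ℝ × ℝ → Submodule ℝ V} {η : ℝ × ℝ → (ℝ × ℝ →L[ℝ] V →L[ℝ] V)}

/-- Skewness and the values of `η` on `dF` determine `η` up to the component `η N`, a multiple of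
`F`; closedness of `η`, applied to `N`, makes this component vanish. -/
theorem IsCurvatureLineFrame.isFrameForm (h : IsCurvatureLineFrame U w F N θ k₁ k₂)
    (hiso : IsIsothermic U Λ η) (hF : IsLift U Λ F) (hη : CoordsCorrespond U η F) :
    IsFrameForm U η w F N θ := by
  have hmem : ∀ x ∈ U, ∀ X, η x X ∈ wedgePerp (Submodule.span ℝ {F x}) := fun x hx X => by
    rw [← hF.span_eq x hx]; exact hiso.mem_wedgePerp x hx X
  have hskew : ∀ x ∈ U, ∀ X y z, lor (η x X y) z = -lor y (η x X z) := fun x hx X y z =>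
    lor_skew_of_mem_wedgePerp (hmem x hx X) y z
  have hself : ∀ x ∈ U, ∀ X y, lor (η x X y) y = 0 := fun x hx X y => by
    have e := hskew x hx X y y
    rw [lor_comm y] at e
    linarith
  have hηF : ∀ x ∈ U, ∀ X, η x X (F x) = 0 := fun x hx X =>
    apply_eq_zero_of_mem_wedgePerp (h.adapted x hx).ff (hmem x hx X)
  have hηu : ∀ x ∈ U, ∀ X, η x X (du F x) = X.1 • F x := fun x hx X =>
    (hη x hx X (1, 0)).trans (by congr 1; simp)
  have hηv : ∀ x ∈ U, ∀ X, η x X (dv F x) = -(X.2 • F x) := fun x hx X =>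
    (hη x hx X (0, 1)).trans (by rw [← neg_smul]; congr 1; simp)
  have hηN' : ∀ X, ∀ x ∈ U, η x X (N x) = (-lor (η x X (N x)) w) • F x := fun X x hx => by
    have ha := h.adapted x hx
    have e := ha.expansion (η x X (N x))
    have e₁ : lor (η x X (N x)) (F x) = 0 := by rw [hskew x hx, hηF x hx, map_zero, neg_zero]
    have e₂ : lor (η x X (N x)) (du F x) = 0 := by
      rw [hskew x hx, hηu x hx, map_smul, lor_comm, ha.fn, smul_zero, neg_zero]
    have e₃ : lor (η x X (N x)) (dv F x) = 0 := by
      rw [hskew x hx, hηv x hx, map_neg, map_smul, lor_comm, ha.fn, smul_zero, neg_zero, neg_zero]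
    rw [e₁, e₂, e₃, hself x hx] at e
    simpa using e
  have hηX : ∀ X : ℝ × ℝ, ContDiffOn ℝ ∞ (fun x => η x X) U := fun X =>
    hiso.smooth.clm_apply contDiffOn_const
  have hsm : ∀ X : ℝ × ℝ, ContDiffOn ℝ ∞ (fun x => -lor (η x X (N x)) w) U := fun X =>
    (contDiffOn_lor ((hηX X).clm_apply h.smooth_N) contDiffOn_const).neg
  have hηN : ∀ x ∈ U, ∀ X, η x X (N x) = 0 := fun x hx => by
    have hdη := differentiableAt_of_contDiffOn h.isOpen hx hiso.smooth
    have hdN := differentiableAt_of_contDiffOn h.isOpen hx h.smooth_N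
    have hdF := differentiableAt_of_contDiffOn h.isOpen hx h.smooth_F
    -- differentiating `η_X N = β_X F`
    have key : ∀ X Z : ℝ × ℝ, fderiv ℝ η x Z X (N x) + η x X (dirDeriv Z N x)
        = (-lor (η x X (N x)) w) • dirDeriv Z F x
          + dirDeriv Z (fun y => -lor (η y X (N y)) w) x • F x := fun X Z => by
      rw [← dirDeriv_smul Z (differentiableAt_of_contDiffOn h.isOpen hx (hsm X)) hdF,
        ← dirDeriv_congr Z h.isOpen hx (hηN' X), dirDeriv, dirDeriv,
        fderiv_clm_apply (differentiableAt_of_contDiffOn h.isOpen hx (hηX X)) hdN,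
        fderiv_clm_apply hdη (differentiableAt_const X)]
      simp [add_comm]
    have k₁' := key (0, 1) (1, 0)
    have k₂' := key (1, 0) (0, 1)
    simp only [← du_eq_dirDeriv, ← dv_eq_dirDeriv] at k₁' k₂'
    rw [h.du_N x hx, map_neg, map_smul, hηu x hx, zero_smul, smul_zero, neg_zero, add_zero,
      hiso.closed x hx] at k₁'
    rw [h.dv_N x hx, map_neg, map_smul, hηv x hx, zero_smul, neg_zero, smul_zero, neg_zero,
      add_zero, k₁'] at k₂'
    obtain ⟨-, e₁, e₂, -, -⟩ := (h.adapted x hx).coeff_eq_zero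
      (x₀ := du (fun y => -lor (η y (0, 1) (N y)) w) x
        - dv (fun y => -lor (η y (1, 0) (N y)) w) x)
      (x₁ := -lor (η x (0, 1) (N x)) w) (x₂ := lor (η x (1, 0) (N x)) w) (x₃ := 0) (x₄ := 0)
      (by linear_combination (norm := module) k₂')
    have z₁ : η x (0, 1) (N x) = 0 := by rw [hηN' (0, 1) x hx, e₁, zero_smul]
    have z₂ : η x (1, 0) (N x) = 0 := by rw [hηN' (1, 0) x hx, e₂, neg_zero, zero_smul]
    intro X
    have hX : X = X.1 • ((1 : ℝ), (0 : ℝ)) + X.2 • ((0 : ℝ), (1 : ℝ)) := by ext <;> simp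
    rw [hX, map_add, map_smul, map_smul]
    simp [z₁, z₂]
  refine ⟨hηF, hηu, hηv, hηN, fun x hx X => ?_⟩
  have ha := h.adapted x hx
  have e := ha.expansion (η x X w)
  have e₁ : lor (η x X w) (F x) = 0 := by rw [hskew x hx, hηF x hx, map_zero, neg_zero]
  have e₂ : lor (η x X w) (du F x) = X.1 := by
    rw [hskew x hx, hηu x hx, map_smul, lor_comm, ha.fw]; simp
  have e₃ : lor (η x X w) (dv F x) = -X.2 := by
    rw [hskew x hx, hηv x hx, map_neg, map_smul, lor_comm, ha.fw]; simp
  have e₄ : lor (η x X w) (N x) = 0 := by rw [hskew x hx, hηN x hx, map_zero, neg_zero]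
  rw [e₁, e₂, e₃, e₄, hself x hx] at e
  rw [e, exp_neg_two_mul]
  module

end

/-! ### Quadratic conserved quantities, coefficient by coefficient -/

theorem parallel_two_iff {U : Set (ℝ × ℝ)} (hU : IsOpen U)
    (η : ℝ × ℝ → (ℝ × ℝ →L[ℝ] V →L[ℝ] V)) {p : Fin 3 → ℝ × ℝ → V}
    (hp : ∀ k, ContDiffOn ℝ ∞ (p k) U) {x : ℝ × ℝ} (hx : x ∈ U) (X : ℝ × ℝ) :
    (∀ t : ℝ, fderiv ℝ (polyEval (d := 2) p t) x X + t • η x X (polyEval (d := 2) p t x) = 0) ↔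
      dirDeriv X (p 0) x = 0 ∧ dirDeriv X (p 1) x + η x X (p 0 x) = 0 ∧
        dirDeriv X (p 2) x + η x X (p 1 x) = 0 ∧ η x X (p 2 x) = 0 := by
  have hd := fun k => differentiableAt_of_contDiffOn hU hx (hp k)
  have he : ∀ t : ℝ, polyEval (d := 2) p t = fun y => p 0 y + t • p 1 y + t ^ 2 • p 2 y := by
    intro t
    funext y
    simp [polyEval, Fin.sum_univ_three]
  have key : ∀ t : ℝ, fderiv ℝ (polyEval (d := 2) p t) x X + t • η x X (polyEval (d := 2) p t x)
      = dirDeriv X (p 0) x + t • (dirDeriv X (p 1) x + η x X (p 0 x))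
        + t ^ 2 • (dirDeriv X (p 2) x + η x X (p 1 x)) + t ^ 3 • η x X (p 2 x) := by
    intro t
    change dirDeriv X (polyEval (d := 2) p t) x + _ = _
    rw [he, dirDeriv_add X ((hd 0).fun_add ((hd 1).fun_const_smul t)) ((hd 2).fun_const_smul _),
      dirDeriv_add X (hd 0) ((hd 1).fun_const_smul t), dirDeriv_const_smul X t _ (hd 1),
      dirDeriv_const_smul X _ _ (hd 2), map_add, map_add, map_smul, map_smul]
    module
  simp only [key]
  constructor
  · intro h
    have h₀ := h 0
    have h₁ := h 1
    have h₂ := h (-1)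
    have h₃ := h 2
    have e₀ : dirDeriv X (p 0) x = 0 := by simpa using h₀
    -- inverting the Vandermonde matrix of the nodes `0, 1, -1, 2`
    refine ⟨e₀, ?_, ?_, ?_⟩
    · linear_combination (norm := module) (-1 / 2 : ℝ) • e₀ + (1 : ℝ) • h₁ - (1 / 3 : ℝ) • h₂
        - (1 / 6 : ℝ) • h₃
    · linear_combination (norm := module) (-1 : ℝ) • e₀ + (1 / 2 : ℝ) • h₁ + (1 / 2 : ℝ) • h₂
    · linear_combination (norm := module) (1 / 2 : ℝ) • e₀ - (1 / 2 : ℝ) • h₁ - (1 / 6 : ℝ) • h₂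
        + (1 / 6 : ℝ) • h₃
  · rintro ⟨h₀, h₁, h₂, h₃⟩ t
    rw [h₀, h₁, h₂, h₃]
    simp

/-! ### The Bianchi system and the explicit quadratic polynomial -/

/-- The left-hand side of the first equation of `BianchiSystem`. -/
noncomputable def bianchiFst (θ k₁ k₂ : ℝ × ℝ → ℝ) (s A B C : ℝ) (x : ℝ × ℝ) : ℝ :=
  du (du (meanCurv k₁ k₂)) x + du θ x * du (meanCurv k₁ k₂) x - dv θ x * dv (meanCurv k₁ k₂) x
    - 1 / 2 * fnM θ k₁ k₂ x * k₁ x - A * k₁ x - B * Real.exp (-2 * θ x) + C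
    - 1 / 2 * fnL θ k₁ k₂ x * s

/-- The left-hand side of the second equation of `BianchiSystem`. -/
noncomputable def bianchiSnd (θ k₁ k₂ : ℝ × ℝ → ℝ) (s A B C : ℝ) (x : ℝ × ℝ) : ℝ :=
  dv (dv (meanCurv k₁ k₂)) x - du θ x * du (meanCurv k₁ k₂) x + dv θ x * dv (meanCurv k₁ k₂) x
    + 1 / 2 * fnM θ k₁ k₂ x * k₂ x + A * k₂ x - B * Real.exp (-2 * θ x) - C
    + 1 / 2 * fnL θ k₁ k₂ x * s

theorem bianchiSystem_iff {U : Set (ℝ × ℝ)} {θ k₁ k₂ : ℝ × ℝ → ℝ} {s A B C : ℝ} :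
    BianchiSystem U θ k₁ k₂ s A B C ↔
      ∀ x ∈ U, bianchiFst θ k₁ k₂ s A B C x = 0 ∧ bianchiSnd θ k₁ k₂ s A B C x = 0 := Iff.rfl

/-- The non-constant part of the left-hand side of the Darboux–Bianchi condition in a space form
of curvature `-s`. -/
noncomputable def darbouxFn (θ k₁ k₂ : ℝ × ℝ → ℝ) (s A B C : ℝ) (x : ℝ × ℝ) : ℝ :=
  Real.exp (2 * θ x) * (du (meanCurv k₁ k₂) x * du (meanCurv k₁ k₂) x
      + dv (meanCurv k₁ k₂) x * dv (meanCurv k₁ k₂) x)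
    + 1 / 4 * (fnM θ k₁ k₂ x * fnM θ k₁ k₂ x) + A * fnM θ k₁ k₂ x - 2 * B * meanCurv k₁ k₂ x
    + C * fnL θ k₁ k₂ x - s / 4 * (fnL θ k₁ k₂ x * fnL θ k₁ k₂ x)

theorem exists_darbouxBianchi_iff {U : Set (ℝ × ℝ)} {θ k₁ k₂ : ℝ × ℝ → ℝ} {s A B C : ℝ} :
    (∃ D, DarbouxBianchi U θ k₁ k₂ (-s) A B C D) ↔
      ∃ c, ∀ x ∈ U, darbouxFn θ k₁ k₂ s A B C x = c := by
  constructor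
  · rintro ⟨D, hD⟩
    refine ⟨-D, fun x hx => ?_⟩
    have := hD x hx
    rw [darbouxFn]
    linear_combination this
  · rintro ⟨c, hc⟩
    refine ⟨-c, fun x hx => ?_⟩
    have := hc x hx
    rw [darbouxFn] at this
    linear_combination this

/-- The explicit linear coefficient in terms of `linearCoeff`: the exponential factors cancel. -/
theorem explicitQuantity_one (w : V) (F N : ℝ × ℝ → V) (θ k₁ k₂ : ℝ × ℝ → ℝ) (A B C : ℝ) :
    explicitQuantity w F N θ k₁ k₂ A B C 1 = linearCoeff w F N θ k₁ k₂
      (fun x => 1 / 2 * lor w w * fnL θ k₁ k₂ x - C) (fun x => -(1 / 2) * fnM θ k₁ k₂ x - A) := by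
  funext x
  have e : Real.exp (θ x) * Real.exp (-θ x) = 1 := by rw [← Real.exp_add]; simp
  simp only [explicitQuantity, linearCoeff, Matrix.cons_val_one, Matrix.cons_val_zero, smul_smul]
  rw [mul_right_comm (Real.exp (θ x)) (du _ x), e, mul_right_comm (Real.exp (θ x)) (dv _ x), e]
  module

theorem explicitQuantity_two (w : V) (F N : ℝ × ℝ → V) (θ k₁ k₂ : ℝ × ℝ → ℝ) (A B C : ℝ) :
    explicitQuantity w F N θ k₁ k₂ A B C 2 = fun x => meanCurv k₁ k₂ x • F x + N x := rfl

theorem explicitQuantity_zero (w : V) (F N : ℝ × ℝ → V) (θ k₁ k₂ : ℝ × ℝ → ℝ) (A B C : ℝ) :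
    explicitQuantity w F N θ k₁ k₂ A B C 0 = fun _ => B • w := rfl

namespace IsCurvatureLineFrame

variable {U : Set (ℝ × ℝ)} {w : V} {F N : ℝ × ℝ → V} {θ k₁ k₂ φ ν : ℝ × ℝ → ℝ}
  {η : ℝ × ℝ → (ℝ × ℝ →L[ℝ] V →L[ℝ] V)}
  (h : IsCurvatureLineFrame U w F N θ k₁ k₂) {x : ℝ × ℝ} (A B C : ℝ)
include h

theorem smooth_explicitQuantity (k : Fin 3) :
    ContDiffOn ℝ ∞ (explicitQuantity w F N θ k₁ k₂ A B C k) U := by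
  fin_cases k
  · exact contDiffOn_const
  · change ContDiffOn ℝ ∞ (explicitQuantity w F N θ k₁ k₂ A B C 1) U
    rw [explicitQuantity_one]
    exact h.smooth_linearCoeff ((contDiffOn_const.mul h.smooth_fnL).sub contDiffOn_const)
      ((contDiffOn_const.mul h.smooth_fnM).sub contDiffOn_const)
  · exact (h.smooth_meanCurv.smul h.smooth_F).add h.smooth_N

/-- The derivative of the explicit linear coefficient; its failure to be `-η (B w)` is measured by
the Bianchi system. -/
theorem dirDeriv_explicitQuantity_one (X : ℝ × ℝ) (hx : x ∈ U) :
    dirDeriv X (explicitQuantity w F N θ k₁ k₂ A B C 1) x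
      = -((bianchiFst θ k₁ k₂ (lor w w) A B C x + B * Real.exp (-2 * θ x)) * X.1) • du F x
      + ((bianchiSnd θ k₁ k₂ (lor w w) A B C x + B * Real.exp (-2 * θ x)) * X.2) • dv F x := by
  have hL := differentiableAt_of_contDiffOn h.isOpen hx h.smooth_fnL
  have hM := differentiableAt_of_contDiffOn h.isOpen hx h.smooth_fnM
  have hφ : ContDiffOn ℝ ∞ (fun x => 1 / 2 * lor w w * fnL θ k₁ k₂ x - C) U :=
    (contDiffOn_const.mul h.smooth_fnL).sub contDiffOn_const
  have hν : ContDiffOn ℝ ∞ (fun x => -(1 / 2) * fnM θ k₁ k₂ x - A) U :=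
    (contDiffOn_const.mul h.smooth_fnM).sub contDiffOn_const
  have eφ : ∀ X, dirDeriv X (fun x => 1 / 2 * lor w w * fnL θ k₁ k₂ x - C) x
      = 1 / 2 * lor w w * dirDeriv X (fnL θ k₁ k₂) x := fun X => by
    rw [dirDeriv_sub X (hL.const_mul _) (differentiableAt_const C), dirDeriv_const,
      dirDeriv_const_mul X _ hL, sub_zero]
  have eν : ∀ X, dirDeriv X (fun x => -(1 / 2) * fnM θ k₁ k₂ x - A) x
      = -(1 / 2) * dirDeriv X (fnM θ k₁ k₂) x := fun X => by
    rw [dirDeriv_sub X (hM.const_mul _) (differentiableAt_const A), dirDeriv_const,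
      dirDeriv_const_mul X _ hM, sub_zero]
  rw [explicitQuantity_one, dirDeriv, fderiv_apply_eq_du_dv, h.du_linearCoeff hφ hν hx,
    h.dv_linearCoeff hφ hν hx, du_eq_dirDeriv (fun _ => _ - C), dv_eq_dirDeriv (fun _ => _ - C),
    du_eq_dirDeriv (fun _ => _ - A), dv_eq_dirDeriv (fun _ => _ - A), eφ, eφ, eν, eν,
    ← du_eq_dirDeriv, ← dv_eq_dirDeriv, ← du_eq_dirDeriv, ← dv_eq_dirDeriv, h.du_fnL hx,
    h.dv_fnL hx, h.du_fnM hx, h.dv_fnM hx, bianchiFst, bianchiSnd]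
  module

theorem dirDeriv_explicitQuantity_two (X : ℝ × ℝ) (hx : x ∈ U) :
    dirDeriv X (explicitQuantity w F N θ k₁ k₂ A B C 2) x
      = dirDeriv X (meanCurv k₁ k₂) x • F x
        - (1 / 2 * fnL θ k₁ k₂ x * Real.exp (-2 * θ x)) • (X.1 • du F x - X.2 • dv F x) := by
  have hH := differentiableAt_of_contDiffOn h.isOpen hx h.smooth_meanCurv
  have hF := differentiableAt_of_contDiffOn h.isOpen hx h.smooth_F
  have hN := differentiableAt_of_contDiffOn h.isOpen hx h.smooth_N
  have e : fnL θ k₁ k₂ x * Real.exp (-2 * θ x) = k₁ x - k₂ x := by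
    rw [fnL, exp_neg_two_mul, mul_right_comm, mul_inv_cancel₀ (Real.exp_pos _).ne', one_mul]
  rw [explicitQuantity_two, dirDeriv_add X (hH.fun_smul hF) hN, dirDeriv_smul X hH hF, mul_assoc,
    e, dirDeriv, dirDeriv, dirDeriv, fderiv_apply_eq_du_dv F, fderiv_apply_eq_du_dv N, h.du_N x hx,
    h.dv_N x hx, meanCurv]
  module

theorem isConservedQuantity_explicit (hη : IsFrameForm U η w F N θ) (hne : U.Nonempty) {c : ℝ}
    (hc : c ≠ 0) (hS : BianchiSystem U θ k₁ k₂ (lor w w) A B C) {p : Fin 3 → ℝ × ℝ → V}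
    (hp : ∀ k, ∀ x ∈ U, p k x = c • explicitQuantity w F N θ k₁ k₂ A B C k x) :
    IsConservedQuantity U η 2 p := by
  have hsm : ∀ k, ContDiffOn ℝ ∞ (p k) U := fun k =>
    ((h.smooth_explicitQuantity A B C k).const_smul c).congr (hp k)
  refine ⟨hsm, ?_, ?_⟩
  · obtain ⟨x, hx⟩ := hne
    refine ⟨x, hx, fun h₀ => ?_⟩
    have e : c • explicitQuantity w F N θ k₁ k₂ A B C 2 x = 0 := (hp 2 x hx).symm.trans h₀
    have e' := (smul_eq_zero.1 e).resolve_left hc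
    rw [explicitQuantity_two] at e'
    have := (h.adapted x hx).coeff_eq_zero (x₀ := meanCurv k₁ k₂ x) (x₁ := 0) (x₂ := 0) (x₃ := 1)
      (x₄ := 0) (by linear_combination (norm := module) e')
    exact one_ne_zero this.2.2.2.1
  · intro t x hx X
    revert t
    rw [parallel_two_iff h.isOpen η hsm hx]
    have hd : ∀ k, dirDeriv X (p k) x
        = c • dirDeriv X (explicitQuantity w F N θ k₁ k₂ A B C k) x := fun k => by
      rw [dirDeriv_congr X h.isOpen hx (hp k), dirDeriv_const_smul X c _
        (differentiableAt_of_contDiffOn h.isOpen hx (h.smooth_explicitQuantity A B C k))]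
    rw [hd, hd, hd, hp 0 x hx, hp 1 x hx, hp 2 x hx, h.dirDeriv_explicitQuantity_one A B C X hx,
      h.dirDeriv_explicitQuantity_two A B C X hx, (bianchiSystem_iff.1 hS x hx).1,
      (bianchiSystem_iff.1 hS x hx).2]
    refine ⟨?_, ?_, ?_, ?_⟩
    · rw [explicitQuantity_zero, dirDeriv_const, smul_zero]
    · rw [explicitQuantity_zero, map_smul, map_smul, hη.apply_w x hx]
      module
    · rw [explicitQuantity_one, map_smul, linearCoeff, sub_eq_add_neg _ (_ • du F x), ← neg_smul,
        hη.apply_combination hx, dirDeriv, fderiv_apply_eq_du_dv]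
      simp only [smul_eq_mul]
      module
    · rw [explicitQuantity_two, map_smul, map_add, map_smul, hη.apply_F x hx, hη.apply_N x hx]
      simp

/-- A quadratic conserved quantity with constant term in `⟨w⟩` is a multiple of the explicit one:
the coefficients of `(d + tη) p(t) = 0` in the frame give `p₂`, then `p₁`, then the system. -/
theorem exists_explicit_of_isConservedQuantity (hη : IsFrameForm U η w F N θ) (hU : IsConnected U)
    {p : Fin 3 → ℝ × ℝ → V} (hp : IsConservedQuantity U η 2 p)
    (hp₀ : ∀ x ∈ U, p 0 x ∈ Submodule.span ℝ {w}) :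
    ∃ c A B C : ℝ, c ≠ 0 ∧ BianchiSystem U θ k₁ k₂ (lor w w) A B C ∧
      ∀ k, ∀ x ∈ U, p k x = c • explicitQuantity w F N θ k₁ k₂ A B C k x := by
  have hsm : ∀ k : Fin 3, ContDiffOn ℝ ∞ (p k) U := hp.smooth
  have hpar : ∀ x ∈ U, ∀ X, _ := fun x hx X =>
    (parallel_two_iff h.isOpen η hsm hx X).1 fun t => hp.parallel t x hx X
  have hFs := h.smooth_F
  have hws : ContDiffOn ℝ ∞ (fun _ : ℝ × ℝ => w) U := contDiffOn_const
  -- the constant term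
  obtain ⟨b, hb⟩ : ∃ b : ℝ, ∀ x ∈ U, p 0 x = b • w := by
    obtain ⟨e, he⟩ := exists_const_of_du_dv_eq_zero h.isOpen hU (hsm 0)
      (fun x hx => (hpar x hx _).1) (fun x hx => (hpar x hx _).1)
    obtain ⟨y, hy⟩ := hU.nonempty
    obtain ⟨b, hb⟩ := Submodule.mem_span_singleton.1 (hp₀ y hy)
    exact ⟨b, fun x hx => by rw [he x hx, hb, he y hy]⟩
  -- the quadratic coefficient is annihilated by `η`, so it is a combination of `F` and `N`
  obtain ⟨α, n, hα, hn, hp₂⟩ : ∃ α n : ℝ × ℝ → ℝ, ContDiffOn ℝ ∞ α U ∧ ContDiffOn ℝ ∞ n U ∧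
      ∀ x ∈ U, p 2 x = α x • F x + n x • N x := by
    refine ⟨fun x => -lor (p 2 x) w - lor w w * lor (p 2 x) (F x), fun x => lor (p 2 x) (N x),
      (contDiffOn_lor (hsm 2) hws).neg.sub (contDiffOn_const.mul (contDiffOn_lor (hsm 2) hFs)),
      contDiffOn_lor (hsm 2) h.smooth_N, fun x hx => ?_⟩
    have ha := h.adapted x hx
    have e := ha.expansion (p 2 x)
    have e₁ := (hpar x hx (1, 0)).2.2.2
    have e₂ := (hpar x hx (0, 1)).2.2.2
    rw [e, hη.apply_combination hx] at e₁ e₂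
    obtain ⟨f₁, f₂, -, -, -⟩ := ha.coeff_eq_zero
      (x₀ := lor (p 2 x) (du F x) / Real.exp (2 * θ x))
      (x₁ := -lor (p 2 x) (F x) * Real.exp (-2 * θ x)) (x₂ := 0) (x₃ := 0) (x₄ := 0)
      (by linear_combination (norm := module) e₁)
    obtain ⟨f₃, -, -, -, -⟩ := ha.coeff_eq_zero
      (x₀ := -(lor (p 2 x) (dv F x) / Real.exp (2 * θ x)))
      (x₁ := 0) (x₂ := lor (p 2 x) (F x) * Real.exp (-2 * θ x)) (x₃ := 0) (x₄ := 0)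
      (by linear_combination (norm := module) e₂)
    have f₄ := (mul_eq_zero.1 f₂).resolve_right (Real.exp_pos _).ne'
    rw [f₁, neg_eq_zero.1 f₃, f₄] at e
    conv_lhs => rw [e]
    module
  -- coefficient functions of the linear coefficient
  obtain ⟨φ, a₁, a₂, ν, ρ, hφ, hν, hp₁⟩ : ∃ φ a₁ a₂ ν ρ : ℝ × ℝ → ℝ, ContDiffOn ℝ ∞ φ U ∧
      ContDiffOn ℝ ∞ ν U ∧ ∀ x ∈ U,
      p 1 x = φ x • F x + a₁ x • du F x + a₂ x • dv F x + ν x • N x + ρ x • w :=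
    ⟨fun x => -lor (p 1 x) w - lor w w * lor (p 1 x) (F x), _, _, fun x => lor (p 1 x) (N x), _,
      (contDiffOn_lor (hsm 1) hws).neg.sub (contDiffOn_const.mul (contDiffOn_lor (hsm 1) hFs)),
      contDiffOn_lor (hsm 1) h.smooth_N, fun x hx => (h.adapted x hx).expansion (p 1 x)⟩
  -- the frame components of `d p₂ + η p₁ = 0`
  have hd₂ : ∀ X, ∀ x ∈ U, (α x • dirDeriv X F x + dirDeriv X α x • F x)
      + (n x • dirDeriv X N x + dirDeriv X n x • N x) + ((X.1 * a₁ x - X.2 * a₂ x) • F x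
        + (ρ x * Real.exp (-2 * θ x)) • (X.1 • du F x - X.2 • dv F x)) = 0 := fun X x hx => by
    have hα' := differentiableAt_of_contDiffOn h.isOpen hx hα
    have hn' := differentiableAt_of_contDiffOn h.isOpen hx hn
    have hF' := differentiableAt_of_contDiffOn h.isOpen hx h.smooth_F
    have hN' := differentiableAt_of_contDiffOn h.isOpen hx h.smooth_N
    have e := (hpar x hx X).2.2.1
    rw [hp₁ x hx, hη.apply_combination hx, dirDeriv_congr X h.isOpen hx hp₂,
      dirDeriv_add X (hα'.fun_smul hF') (hn'.fun_smul hN'), dirDeriv_smul X hα' hF',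
      dirDeriv_smul X hn' hN'] at e
    exact e
  have hu : ∀ x ∈ U, du α x + a₁ x = 0 ∧
      α x - n x * k₁ x + ρ x * Real.exp (-2 * θ x) = 0 ∧ du n x = 0 := fun x hx => by
    have e := hd₂ (1, 0) x hx
    simp only [← du_eq_dirDeriv, h.du_N x hx] at e
    obtain ⟨f₀, f₁, -, f₃, -⟩ := (h.adapted x hx).coeff_eq_zero (x₀ := du α x + a₁ x)
      (x₁ := α x - n x * k₁ x + ρ x * Real.exp (-2 * θ x)) (x₂ := 0) (x₃ := du n x) (x₄ := 0)
      (by linear_combination (norm := module) e)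
    exact ⟨f₀, f₁, f₃⟩
  have hv : ∀ x ∈ U, dv α x - a₂ x = 0 ∧
      α x - n x * k₂ x - ρ x * Real.exp (-2 * θ x) = 0 ∧ dv n x = 0 := fun x hx => by
    have e := hd₂ (0, 1) x hx
    simp only [← dv_eq_dirDeriv, h.dv_N x hx] at e
    obtain ⟨f₀, -, f₂, f₃, -⟩ := (h.adapted x hx).coeff_eq_zero (x₀ := dv α x - a₂ x)
      (x₁ := 0) (x₂ := α x - n x * k₂ x - ρ x * Real.exp (-2 * θ x)) (x₃ := dv n x) (x₄ := 0)
      (by linear_combination (norm := module) e)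
    exact ⟨f₀, f₂, f₃⟩
  obtain ⟨c, hc⟩ := exists_const_of_du_dv_eq_zero h.isOpen hU hn (fun x hx => (hu x hx).2.2)
    fun x hx => (hv x hx).2.2
  have hα' : ∀ x ∈ U, α x = c * meanCurv k₁ k₂ x := fun x hx => by
    have e₁ := (hu x hx).2.1
    have e₂ := (hv x hx).2.1
    rw [hc x hx] at e₁ e₂
    rw [meanCurv]
    linear_combination (e₁ + e₂) / 2
  have hc₀ : c ≠ 0 := by
    rintro rfl
    obtain ⟨x, hx, h₀⟩ := hp.top_ne_zero
    refine h₀ ((hp₂ x hx).trans ?_)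
    rw [hα' x hx, hc x hx]
    simp
  have hρ : ∀ x ∈ U, ρ x = c * (1 / 2 * fnL θ k₁ k₂ x) := fun x hx => by
    have e₁ := (hu x hx).2.1
    have e₂ := (hv x hx).2.1
    rw [hc x hx, exp_neg_two_mul] at e₁ e₂
    have hE := (Real.exp_pos (2 * θ x)).ne'
    rw [fnL]
    field_simp at e₁ e₂ ⊢
    linear_combination e₁ - e₂
  have hdα : ∀ X, ∀ x ∈ U, dirDeriv X α x = c * dirDeriv X (meanCurv k₁ k₂) x := fun X x hx => by
    rw [dirDeriv_congr X h.isOpen hx hα', dirDeriv_const_mul X c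
      (differentiableAt_of_contDiffOn h.isOpen hx h.smooth_meanCurv)]
  -- after division by `c` the linear coefficient is of the form `linearCoeff`
  have hφc : ContDiffOn ℝ ∞ (fun x => c⁻¹ * φ x) U := contDiffOn_const.mul hφ
  have hνc : ContDiffOn ℝ ∞ (fun x => c⁻¹ * ν x) U := contDiffOn_const.mul hν
  have hp₁' : ∀ x ∈ U, p 1 x = c • linearCoeff w F N θ k₁ k₂ (fun x => c⁻¹ * φ x)
      (fun x => c⁻¹ * ν x) x := fun x hx => by
    have e₁ := (hu x hx).1
    have e₂ := (hv x hx).1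
    rw [du_eq_dirDeriv, hdα _ x hx, ← du_eq_dirDeriv] at e₁
    rw [dv_eq_dirDeriv, hdα _ x hx, ← dv_eq_dirDeriv] at e₂
    rw [hp₁ x hx, hρ x hx, eq_neg_of_add_eq_zero_right e₁, ← sub_eq_zero.1 e₂, linearCoeff]
    simp only [smul_add, smul_sub, smul_smul, mul_inv_cancel_left₀ hc₀]
    module
  have hd₁ : ∀ X, ∀ x ∈ U, c • dirDeriv X (linearCoeff w F N θ k₁ k₂ (fun x => c⁻¹ * φ x)
      (fun x => c⁻¹ * ν x)) x + (b * Real.exp (-2 * θ x)) • (X.1 • du F x - X.2 • dv F x) = 0 :=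
    fun X x hx => by
    have e := (hpar x hx X).2.1
    rwa [hb x hx, map_smul, hη.apply_w x hx, dirDeriv_congr X h.isOpen hx hp₁',
      dirDeriv_const_smul X c _ (differentiableAt_of_contDiffOn h.isOpen hx
        (h.smooth_linearCoeff hφc hνc)), smul_smul] at e
  -- the `F`- and `N`-components of `d p₁ + η p₀ = 0` determine `φ` and `ν` up to constants
  have hu' : ∀ x ∈ U,
      du (fun x => c⁻¹ * φ x) x = Real.exp (2 * θ x) * lor w w * du (meanCurv k₁ k₂) x ∧
      du (fun x => c⁻¹ * ν x) x = Real.exp (2 * θ x) * k₁ x * du (meanCurv k₁ k₂) x :=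
    fun x hx => by
    have e := hd₁ (1, 0) x hx
    rw [← du_eq_dirDeriv, h.du_linearCoeff hφc hνc hx] at e
    obtain ⟨f₀, -, -, f₃, -⟩ := (h.adapted x hx).coeff_eq_zero
      (x₀ := c * (du (fun x => c⁻¹ * φ x) x
        - Real.exp (2 * θ x) * lor w w * du (meanCurv k₁ k₂) x))
      (x₁ := c * (c⁻¹ * φ x - du (du (meanCurv k₁ k₂)) x - du θ x * du (meanCurv k₁ k₂) x
        + dv θ x * dv (meanCurv k₁ k₂) x - c⁻¹ * ν x * k₁ x) + b * Real.exp (-2 * θ x))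
      (x₂ := 0)
      (x₃ := c * (du (fun x => c⁻¹ * ν x) x
        - Real.exp (2 * θ x) * k₁ x * du (meanCurv k₁ k₂) x))
      (x₄ := 0) (by linear_combination (norm := module) e)
    exact ⟨sub_eq_zero.1 ((mul_eq_zero.1 f₀).resolve_left hc₀),
      sub_eq_zero.1 ((mul_eq_zero.1 f₃).resolve_left hc₀)⟩
  have hv' : ∀ x ∈ U,
      dv (fun x => c⁻¹ * φ x) x = -(Real.exp (2 * θ x) * lor w w * dv (meanCurv k₁ k₂) x) ∧
      dv (fun x => c⁻¹ * ν x) x = -(Real.exp (2 * θ x) * k₂ x * dv (meanCurv k₁ k₂) x) := by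
    intro x hx
    have e := hd₁ (0, 1) x hx
    rw [← dv_eq_dirDeriv, h.dv_linearCoeff hφc hνc hx] at e
    obtain ⟨f₀, -, -, f₃, -⟩ := (h.adapted x hx).coeff_eq_zero
      (x₀ := c * (dv (fun x => c⁻¹ * φ x) x
        + Real.exp (2 * θ x) * lor w w * dv (meanCurv k₁ k₂) x))
      (x₁ := 0)
      (x₂ := c * (c⁻¹ * φ x + dv (dv (meanCurv k₁ k₂)) x - du θ x * du (meanCurv k₁ k₂) x
        + dv θ x * dv (meanCurv k₁ k₂) x - c⁻¹ * ν x * k₂ x) - b * Real.exp (-2 * θ x))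
      (x₃ := c * (dv (fun x => c⁻¹ * ν x) x
        + Real.exp (2 * θ x) * k₂ x * dv (meanCurv k₁ k₂) x))
      (x₄ := 0) (by linear_combination (norm := module) e)
    exact ⟨eq_neg_of_add_eq_zero_left ((mul_eq_zero.1 f₀).resolve_left hc₀),
      eq_neg_of_add_eq_zero_left ((mul_eq_zero.1 f₃).resolve_left hc₀)⟩
  obtain ⟨C, hC⟩ : ∃ C : ℝ, ∀ x ∈ U, c⁻¹ * φ x = 1 / 2 * lor w w * fnL θ k₁ k₂ x - C := by
    have hd : ∀ X, ∀ x ∈ U, dirDeriv X (fun x => c⁻¹ * φ x - 1 / 2 * lor w w * fnL θ k₁ k₂ x) x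
        = dirDeriv X (fun x => c⁻¹ * φ x) x - 1 / 2 * lor w w * dirDeriv X (fnL θ k₁ k₂) x :=
      fun X x hx => by
      have hL := differentiableAt_of_contDiffOn h.isOpen hx h.smooth_fnL
      rw [dirDeriv_sub X (differentiableAt_of_contDiffOn h.isOpen hx hφc) (hL.const_mul _),
        dirDeriv_const_mul X _ hL]
    obtain ⟨C, hC⟩ := exists_const_of_du_dv_eq_zero h.isOpen hU
      (hφc.sub (contDiffOn_const.mul h.smooth_fnL))
      (fun x hx => (hd _ x hx).trans (by
        rw [← du_eq_dirDeriv, ← du_eq_dirDeriv, (hu' x hx).1, h.du_fnL hx]; ring))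
      (fun x hx => (hd _ x hx).trans (by
        rw [← dv_eq_dirDeriv, ← dv_eq_dirDeriv, (hv' x hx).1, h.dv_fnL hx]; ring))
    exact ⟨-C, fun x hx => by linear_combination hC x hx⟩
  obtain ⟨A, hA⟩ : ∃ A : ℝ, ∀ x ∈ U, c⁻¹ * ν x = -(1 / 2) * fnM θ k₁ k₂ x - A := by
    have hd : ∀ X, ∀ x ∈ U, dirDeriv X (fun x => c⁻¹ * ν x - -(1 / 2) * fnM θ k₁ k₂ x) x
        = dirDeriv X (fun x => c⁻¹ * ν x) x - -(1 / 2) * dirDeriv X (fnM θ k₁ k₂) x :=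
      fun X x hx => by
      have hM := differentiableAt_of_contDiffOn h.isOpen hx h.smooth_fnM
      rw [dirDeriv_sub X (differentiableAt_of_contDiffOn h.isOpen hx hνc) (hM.const_mul _),
        dirDeriv_const_mul X _ hM]
    obtain ⟨A, hA⟩ := exists_const_of_du_dv_eq_zero h.isOpen hU
      (hνc.sub (contDiffOn_const.mul h.smooth_fnM))
      (fun x hx => (hd _ x hx).trans (by
        rw [← du_eq_dirDeriv, ← du_eq_dirDeriv, (hu' x hx).2, h.du_fnM hx]; ring))
      (fun x hx => (hd _ x hx).trans (by
        rw [← dv_eq_dirDeriv, ← dv_eq_dirDeriv, (hv' x hx).2, h.dv_fnM hx]; ring))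
    exact ⟨-A, fun x hx => by linear_combination hA x hx⟩
  have hex : ∀ x ∈ U, linearCoeff w F N θ k₁ k₂ (fun x => c⁻¹ * φ x) (fun x => c⁻¹ * ν x) x
      = explicitQuantity w F N θ k₁ k₂ A (c⁻¹ * b) C 1 x := fun x hx => by
    simp only [explicitQuantity_one, linearCoeff, hC x hx, hA x hx]
  refine ⟨c, A, c⁻¹ * b, C, hc₀, bianchiSystem_iff.2 fun x hx => ?_, fun k x hx => ?_⟩
  · -- the remaining components of `d p₁ + η p₀ = 0`
    have e := fun X => hd₁ X x hx
    simp only [dirDeriv_congr _ h.isOpen hx hex, h.dirDeriv_explicitQuantity_one _ _ _ _ hx] at e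
    obtain ⟨-, f₁, -⟩ := (h.adapted x hx).coeff_eq_zero (x₀ := 0)
      (x₁ := -(c * bianchiFst θ k₁ k₂ (lor w w) A (c⁻¹ * b) C x)) (x₂ := 0) (x₃ := 0) (x₄ := 0)
      (by
        rw [← e (1, 0)]
        simp only [add_mul, mul_assoc, smul_add, smul_smul, mul_add, mul_neg,
          mul_inv_cancel_left₀ hc₀]
        module)
    obtain ⟨-, -, f₂, -⟩ := (h.adapted x hx).coeff_eq_zero (x₀ := 0) (x₁ := 0)
      (x₂ := c * bianchiSnd θ k₁ k₂ (lor w w) A (c⁻¹ * b) C x) (x₃ := 0) (x₄ := 0)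
      (by
        rw [← e (0, 1)]
        simp only [add_mul, mul_assoc, smul_add, smul_smul, mul_add, mul_neg,
          mul_inv_cancel_left₀ hc₀]
        module)
    exact ⟨(mul_eq_zero.1 (neg_eq_zero.1 f₁)).resolve_left hc₀,
      (mul_eq_zero.1 f₂).resolve_left hc₀⟩
  · fin_cases k
    · change p 0 x = c • explicitQuantity w F N θ k₁ k₂ A (c⁻¹ * b) C 0 x
      rw [hb x hx, explicitQuantity_zero, smul_smul, mul_inv_cancel_left₀ hc₀]
    · exact (hp₁' x hx).trans (by rw [hex x hx]; rfl)
    · change p 2 x = c • explicitQuantity w F N θ k₁ k₂ A (c⁻¹ * b) C 2 x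
      rw [hp₂ x hx, hα' x hx, hc x hx, explicitQuantity_two]
      module

/-! ### The Darboux–Bianchi condition as a first integral -/

theorem smooth_darbouxFn (s : ℝ) : ContDiffOn ℝ ∞ (darbouxFn θ k₁ k₂ s A B C) U :=
  have hu := contDiffOn_du h.isOpen h.smooth_meanCurv
  have hv := contDiffOn_dv h.isOpen h.smooth_meanCurv
  (((((h.smooth_exp.mul ((hu.mul hu).add (hv.mul hv))).add
    (contDiffOn_const.mul (h.smooth_fnM.mul h.smooth_fnM))).add
    (contDiffOn_const.mul h.smooth_fnM)).sub (contDiffOn_const.mul h.smooth_meanCurv)).add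
    (contDiffOn_const.mul h.smooth_fnL)).sub
    (contDiffOn_const.mul (h.smooth_fnL.mul h.smooth_fnL))

theorem dirDeriv_darbouxFn (s : ℝ) (X : ℝ × ℝ) (hx : x ∈ U) :
    dirDeriv X (darbouxFn θ k₁ k₂ s A B C) x
      = 2 * Real.exp (2 * θ x) * (dirDeriv X θ x * (du (meanCurv k₁ k₂) x ^ 2
          + dv (meanCurv k₁ k₂) x ^ 2)
        + du (meanCurv k₁ k₂) x * dirDeriv X (du (meanCurv k₁ k₂)) x
        + dv (meanCurv k₁ k₂) x * dirDeriv X (dv (meanCurv k₁ k₂)) x)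
      + (1 / 2 * fnM θ k₁ k₂ x + A) * dirDeriv X (fnM θ k₁ k₂) x
      - 2 * B * dirDeriv X (meanCurv k₁ k₂) x
      + (C - s / 2 * fnL θ k₁ k₂ x) * dirDeriv X (fnL θ k₁ k₂) x := by
  have hu := differentiableAt_of_contDiffOn h.isOpen hx (contDiffOn_du h.isOpen h.smooth_meanCurv)
  have hv := differentiableAt_of_contDiffOn h.isOpen hx (contDiffOn_dv h.isOpen h.smooth_meanCurv)
  have hH := differentiableAt_of_contDiffOn h.isOpen hx h.smooth_meanCurv
  have hL := differentiableAt_of_contDiffOn h.isOpen hx h.smooth_fnL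
  have hM := differentiableAt_of_contDiffOn h.isOpen hx h.smooth_fnM
  have hθ := differentiableAt_of_contDiffOn h.isOpen hx h.smooth_θ
  have hE := differentiableAt_of_contDiffOn h.isOpen hx h.smooth_exp
  have huv := (hu.fun_mul hu).fun_add (hv.fun_mul hv)
  have d₁ := hE.fun_mul huv
  have d₂ := (hM.fun_mul hM).const_mul (1 / 4)
  have d₃ := hM.const_mul A
  have d₄ := hH.const_mul (2 * B)
  have d₅ := hL.const_mul C
  have d₆ := (hL.fun_mul hL).const_mul (s / 4)
  change dirDeriv X (fun x => Real.exp (2 * θ x) * (du (meanCurv k₁ k₂) x * du (meanCurv k₁ k₂) x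
      + dv (meanCurv k₁ k₂) x * dv (meanCurv k₁ k₂) x)
    + 1 / 4 * (fnM θ k₁ k₂ x * fnM θ k₁ k₂ x) + A * fnM θ k₁ k₂ x - 2 * B * meanCurv k₁ k₂ x
    + C * fnL θ k₁ k₂ x - s / 4 * (fnL θ k₁ k₂ x * fnL θ k₁ k₂ x)) x = _
  rw [dirDeriv_sub X ((((d₁.fun_add d₂).fun_add d₃).fun_sub d₄).fun_add d₅) d₆,
    dirDeriv_add X (((d₁.fun_add d₂).fun_add d₃).fun_sub d₄) d₅,
    dirDeriv_sub X ((d₁.fun_add d₂).fun_add d₃) d₄, dirDeriv_add X (d₁.fun_add d₂) d₃,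
    dirDeriv_add X d₁ d₂, dirDeriv_mul X hE huv, dirDeriv_exp_two_mul X hθ,
    dirDeriv_add X (hu.fun_mul hu) (hv.fun_mul hv), dirDeriv_mul X hu hu, dirDeriv_mul X hv hv,
    dirDeriv_const_mul X _ (hM.fun_mul hM), dirDeriv_mul X hM hM, dirDeriv_const_mul X _ hM,
    dirDeriv_const_mul X _ hH, dirDeriv_const_mul X _ hL, dirDeriv_const_mul X _ (hL.fun_mul hL),
    dirDeriv_mul X hL hL]
  ring

theorem du_darbouxFn (s : ℝ) (hx : x ∈ U) :
    du (darbouxFn θ k₁ k₂ s A B C) x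
      = 2 * Real.exp (2 * θ x) * du (meanCurv k₁ k₂) x * bianchiFst θ k₁ k₂ s A B C x := by
  have hE := mul_inv_cancel₀ (Real.exp_pos (2 * θ x)).ne'
  rw [du_eq_dirDeriv, h.dirDeriv_darbouxFn A B C s _ hx]
  simp only [← du_eq_dirDeriv]
  rw [du_dv_comm h.isOpen hx h.smooth_meanCurv, h.dv_du_meanCurv hx, h.du_fnL hx, h.du_fnM hx,
    bianchiFst, exp_neg_two_mul]
  linear_combination (2 * B * du (meanCurv k₁ k₂) x) * hE

theorem dv_darbouxFn (s : ℝ) (hx : x ∈ U) :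
    dv (darbouxFn θ k₁ k₂ s A B C) x
      = 2 * Real.exp (2 * θ x) * dv (meanCurv k₁ k₂) x * bianchiSnd θ k₁ k₂ s A B C x := by
  have hE := mul_inv_cancel₀ (Real.exp_pos (2 * θ x)).ne'
  rw [dv_eq_dirDeriv, h.dirDeriv_darbouxFn A B C s _ hx]
  simp only [← dv_eq_dirDeriv]
  rw [h.dv_du_meanCurv hx, h.dv_fnL hx, h.dv_fnM hx, bianchiSnd, exp_neg_two_mul]
  linear_combination (2 * B * dv (meanCurv k₁ k₂) x) * hE

theorem exists_darbouxBianchi (hU : IsConnected U) {s : ℝ}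
    (hS : BianchiSystem U θ k₁ k₂ s A B C) : ∃ D, DarbouxBianchi U θ k₁ k₂ (-s) A B C D :=
  exists_darbouxBianchi_iff.2 <|
    exists_const_of_du_dv_eq_zero h.isOpen hU (h.smooth_darbouxFn A B C s)
      (fun x hx => by rw [h.du_darbouxFn A B C s hx, (bianchiSystem_iff.1 hS x hx).1, mul_zero])
      (fun x hx => by rw [h.dv_darbouxFn A B C s hx, (bianchiSystem_iff.1 hS x hx).2, mul_zero])

theorem bianchiSystem_of_darbouxBianchi
    (hH : ∀ x ∈ U, du (meanCurv k₁ k₂) x * dv (meanCurv k₁ k₂) x ≠ 0) {s D : ℝ}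
    (hD : DarbouxBianchi U θ k₁ k₂ (-s) A B C D) : BianchiSystem U θ k₁ k₂ s A B C := by
  obtain ⟨c, hc⟩ := exists_darbouxBianchi_iff.1 ⟨D, hD⟩
  refine bianchiSystem_iff.2 fun x hx => ?_
  have hE := (Real.exp_pos (2 * θ x)).ne'
  have hu := left_ne_zero_of_mul (hH x hx)
  have hv := right_ne_zero_of_mul (hH x hx)
  have e₁ := h.du_darbouxFn A B C s hx
  have e₂ := h.dv_darbouxFn A B C s hx
  rw [du_eq_dirDeriv, dirDeriv_eq_zero_of_const _ h.isOpen hx hc] at e₁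
  rw [dv_eq_dirDeriv, dirDeriv_eq_zero_of_const _ h.isOpen hx hc] at e₂
  exact ⟨(mul_eq_zero.1 e₁.symm).resolve_left (mul_ne_zero (mul_ne_zero two_ne_zero hE) hu),
    (mul_eq_zero.1 e₂.symm).resolve_left (mul_ne_zero (mul_ne_zero two_ne_zero hE) hv)⟩

end IsCurvatureLineFrame

end Isothermic

/-! ### Special isothermic surfaces of type 2 -/

theorem mainTheorem1
    (U : Set (ℝ × ℝ)) (hUo : IsOpen U) (hUc : IsConnected U)
    (Λ : ℝ × ℝ → Submodule ℝ Isothermic.V)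
    (η : ℝ × ℝ → (ℝ × ℝ →L[ℝ] Isothermic.V →L[ℝ] Isothermic.V))
    (hiso : Isothermic.IsIsothermic U Λ η)
    (w : Isothermic.V) (hw : w ≠ 0)
    (F N : ℝ × ℝ → Isothermic.V)
    (hF : Isothermic.IsLift U Λ F) (hFw : ∀ x ∈ U, F x ∈ Isothermic.spaceForm w)
    (hN : Isothermic.IsUnitNormal U w F N)
    (θ k₁ k₂ : ℝ × ℝ → ℝ)
    (hcoord : Isothermic.IsConformalCurvatureLine U F N θ k₁ k₂)
    (hη : Isothermic.CoordsCorrespond U η F) :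
    -- the characterisation of type 2 in `E(w)`
    (Isothermic.IsSpecialIsothermic U Λ η 2 w ↔
      ∃ A B C : ℝ, Isothermic.BianchiSystem U θ k₁ k₂ (Isothermic.lor w w) A B C) ∧
    -- the explicit form of all conserved quantities involved
    (∀ p : Fin 3 → ℝ × ℝ → Isothermic.V,
      (Isothermic.IsConservedQuantity U η 2 p ∧
          ∀ x ∈ U, p 0 x ∈ Submodule.span ℝ {w}) ↔
        ∃ c A B C : ℝ, c ≠ 0 ∧
          Isothermic.BianchiSystem U θ k₁ k₂ (Isothermic.lor w w) A B C ∧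
          ∀ k, ∀ x ∈ U, p k x = c • Isothermic.explicitQuantity w F N θ k₁ k₂ A B C k x) ∧
    -- the relation with the classical Darboux–Bianchi condition
    (∀ A B C : ℝ, Isothermic.BianchiSystem U θ k₁ k₂ (Isothermic.lor w w) A B C →
      ∃ D : ℝ, Isothermic.DarbouxBianchi U θ k₁ k₂ (-Isothermic.lor w w) A B C D) ∧
    ((∀ x ∈ U, Isothermic.du (Isothermic.meanCurv k₁ k₂) x *
          Isothermic.dv (Isothermic.meanCurv k₁ k₂) x ≠ 0) →
      (∀ A B C : ℝ, Isothermic.BianchiSystem U θ k₁ k₂ (Isothermic.lor w w) A B C ↔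
        ∃ D : ℝ, Isothermic.DarbouxBianchi U θ k₁ k₂ (-Isothermic.lor w w) A B C D) ∧
      (Isothermic.IsSpecialIsothermic U Λ η 2 w ↔
        ∃ A B C D : ℝ,
          Isothermic.DarbouxBianchi U θ k₁ k₂ (-Isothermic.lor w w) A B C D)) := by
  have h := hcoord.isCurvatureLineFrame hUo hF.smooth hFw hN
  have hηf := h.isFrameForm hiso hF hη
  have h₂ : ∀ p : Fin 3 → ℝ × ℝ → Isothermic.V,
      (Isothermic.IsConservedQuantity U η 2 p ∧ ∀ x ∈ U, p 0 x ∈ Submodule.span ℝ {w}) ↔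
        ∃ c A B C : ℝ, c ≠ 0 ∧
          Isothermic.BianchiSystem U θ k₁ k₂ (Isothermic.lor w w) A B C ∧
          ∀ k, ∀ x ∈ U, p k x = c • Isothermic.explicitQuantity w F N θ k₁ k₂ A B C k x := by
    refine fun p => ⟨fun hp => h.exists_explicit_of_isConservedQuantity hηf hUc hp.1 hp.2, ?_⟩
    rintro ⟨c, A, B, C, hc, hS, hp⟩
    refine ⟨h.isConservedQuantity_explicit A B C hηf hUc.nonempty hc hS hp, fun x hx => ?_⟩
    rw [hp 0 x hx, Isothermic.explicitQuantity_zero]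
    exact Submodule.smul_mem _ _ (Submodule.smul_mem _ _ (Submodule.mem_span_singleton_self w))
  have h₁ : Isothermic.IsSpecialIsothermic U Λ η 2 w ↔
      ∃ A B C : ℝ, Isothermic.BianchiSystem U θ k₁ k₂ (Isothermic.lor w w) A B C := by
    constructor
    · rintro ⟨-, p, hp⟩
      obtain ⟨c, A, B, C, -, hS, -⟩ := (h₂ p).1 hp
      exact ⟨A, B, C, hS⟩
    · rintro ⟨A, B, C, hS⟩
      exact ⟨hiso, Isothermic.explicitQuantity w F N θ k₁ k₂ A B C,
        (h₂ _).2 ⟨1, A, B, C, one_ne_zero, hS, fun k x _ => (one_smul ℝ _).symm⟩⟩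
  refine ⟨h₁, h₂, fun A B C hS => h.exists_darbouxBianchi A B C hUc hS, fun hH => ?_⟩
  have h₃ : ∀ A B C : ℝ, Isothermic.BianchiSystem U θ k₁ k₂ (Isothermic.lor w w) A B C ↔
      ∃ D : ℝ, Isothermic.DarbouxBianchi U θ k₁ k₂ (-Isothermic.lor w w) A B C D :=
    fun A B C => ⟨fun hS => h.exists_darbouxBianchi A B C hUc hS,
      fun ⟨_, hD⟩ => h.bianchiSystem_of_darbouxBianchi A B C hH hD⟩
  exact ⟨h₃, by simp only [h₁, h₃]⟩
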